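/- Let $D\ge 2$ and let $\mathcal G_1,\dots,\mathcal G_D$ be disjoint finite connected undirected graphs with positive edge weights, where $\mathcal G_k$ has $N_k$ nodes and weighted Laplacian $\mathbf L_k$; let $N=\sum_k N_k$ and $\mathbf L_{sub}=\operatorname{diag}(\mathbf L_1,\dots,\mathbf L_D)\in\mathbb R^{N\times N}$. Choose a connecting node $s_k$ in each $\mathcal G_k$, and let $\mathcal E_{con}$ be a set of undirected edges with positive weights $w(r,s)$ between connecting nodes of different subgraphs. For $\beta\ge 0$ put $$\mathbf A=\mathbf I-\mathbf L_{sub},\qquad \mathbf B=\sum_{\{r,s\}\in\mathcal E_{con}}\beta\,w(r,s)\,\mathbf b_{rs}\mathbf b_{rs}^T,\qquad \overline{\mathbf A}=\overline{\mathbf A}(p)=\mathbf A-p\,\mathbf B,$$ where $\mathbf b_{rs}\in\mathbb R^N$ has entry $1$ at $r$, $-1$ at $s$ and $0$ elsewhere. Thus $\overline{\mathbf A}$ is the expected weight matrix of the consensus network whose connecting edges are each active with probability $p$. Let $\rho_{ess}(\overline{\mathbf A})$ be its essential spectral radius, i.e. its second largest eigenvalue, counted with multiplicity. Let $\widehat{\mathbf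 L}_{con}\in\mathbb R^{D\times D}$ be the weighted Laplacian of the graph formed by the connecting nodes $s_1,\dots,s_D$ and $\mathcal E_{con}$ (the connecting graph), let $\mathbf R=\operatorname{diag}(N_1,\dots,N_D)$ and $\widehat{\mathbf M}=\mathbf R^{-1/2}\widehat{\mathbf L}_{con}\mathbf R^{-1/2}$, and let $\lambda_2=\lambda_2(\widehat{\mathbf M})$ be the second smallest eigenvalue of $\widehat{\mathbf M}$, counted with multiplicity. Let $\widehat{\mathcal S}$ be the $D\times D$ diagonal matrix with entries $\widehat{\mathcal S}(k,k)=N_k\,\mathbf L_k^\dagger(s_k,s_k)$, where $\mathbf L_k^\dagger$ is the Moore-Penrose inverse of $\mathbf L_k$. Then the following hold. 1. If the connecting graph is connected, then $\lambda_2$ is the smallest nonzero eigenvalue of $\widehat{\mathbf M}$. 2. To first order in $p$: as $p\to 0$ with $p\ge 0$, $$\rho_{ess}(\overline{\mathbf A})=1-p\beta\lambda_2+O(p^2).$$ 3. To second order in $p$: if the eigenvalue $\lambda_2$ of $\widehat{\mathbf M}$ is simple and $\mathbf u_2$ is any real unit eigenvector of $\widehat{\mathbf M}$ for $\lambda_2$,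 then as $p\to 0$ with $p\ge 0$, $$\rho_{ess}(\overline{\mathbf A})=1-p\beta\lambda_2+p^2\beta^2\lambda_2^2\,(\mathbf u_2^*\widehat{\mathcal S}\mathbf u_2)+O(p^3).$$ 4. In general, whether or not $\lambda_2$ is simple, the maximum of $\mathbf u^*\widehat{\mathcal S}\mathbf u$ over the real unit eigenvectors $\mathbf u$ of $\widehat{\mathbf M}$ for $\lambda_2$ is attained, and the expansion in 3 holds for every $\mathbf u_2$ that attains it. The constants in $O(\cdot)$ may depend on the network and on $\beta$, but not on $p$. -/

import Mathlib

open Matrix Asymptotics Topology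

noncomputable section

/-- A weighted undirected simple graph: every edge carries a positive weight.  The weight function
is extended by `0` to the pairs that are not edges. -/
structure WeightedGraph (V : Type*) where
  graph : SimpleGraph V
  weight : V → V → ℝ
  weight_symm : ∀ r s, weight r s = weight s r
  weight_pos : ∀ r s, graph.Adj r s → 0 < weight r s
  weight_eq_zero : ∀ r s, ¬ graph.Adj r s → weight r s = 0

namespace WeightedGraph

variable {V : Type*} [DecidableEq V]

/-- The weighted Laplacian matrix. -/
def laplacian [Fintype V] (G : WeightedGraph V) : Matrix V V ℝ :=
  Matrix.of fun r s => if r = s then ∑ k, G.weight r k else - G.weight r s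

theorem laplacian_isHermitian [Fintype V] (G : WeightedGraph V) : G.laplacian.IsHermitian := by
  ext r s
  by_cases h : r = s
  · subst h; simp [laplacian]
  · simp [laplacian, h, Ne.symm h, G.weight_symm r s]

/-- The vector with entry `1` at `r`, entry `-1` at `s`, and all other entries `0`. -/
def edgeVector (r s : V) : V → ℝ := Pi.single r 1 - Pi.single s 1

/-- The matrix `β · w(r,s) · b bᵀ` of the edge `e = {r,s}`, where `b = edgeVector r s`. -/
def edgeMatrix (G : WeightedGraph V) (β : ℝ) (e : Sym2 V) : Matrix V V ℝ :=
  Sym2.lift ⟨fun r s => (β * G.weight r s) • vecMulVec (edgeVector r s) (edgeVector r s), by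
    intro r s
    have h : edgeVector r s = - edgeVector s r := by simp [edgeVector]
    beta_reduce
    rw [h, G.weight_symm r s]
    ext i j
    simp [vecMulVec]⟩ e

theorem edgeMatrix_isHermitian (G : WeightedGraph V) (β : ℝ) (e : Sym2 V) :
    (G.edgeMatrix β e).IsHermitian := by
  induction e using Sym2.ind with
  | _ r s =>
    ext i j
    simp [edgeMatrix, vecMulVec, mul_comm]

open Classical in
/-- The sum of the edge matrices over all edges. -/
def edgeMatrixSum [Fintype V] (G : WeightedGraph V) (β : ℝ) : Matrix V V ℝ :=
  ∑ e ∈ G.graph.edgeFinset, G.edgeMatrix β e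

theorem edgeMatrixSum_isHermitian [Fintype V] (G : WeightedGraph V) (β : ℝ) :
    (G.edgeMatrixSum β).IsHermitian := by
  unfold edgeMatrixSum Matrix.IsHermitian
  rw [conjTranspose_sum]
  exact Finset.sum_congr rfl fun e _ => G.edgeMatrix_isHermitian β e

end WeightedGraph

section Spectral

variable {n : Type*} [Fintype n] [DecidableEq n] {A : Matrix n n ℝ}

/-- The second largest eigenvalue (counted with multiplicity) of a real symmetric matrix;
`eigenvalues₀` lists the eigenvalues in decreasing order. -/
def secondLargestEigenvalue (hA : A.IsHermitian) (hn : 2 ≤ Fintype.card n) : ℝ :=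
  hA.eigenvalues₀ ⟨1, by omega⟩

/-- The second smallest eigenvalue (counted with multiplicity) of a real symmetric matrix. -/
def secondSmallestEigenvalue (hA : A.IsHermitian) (hn : 2 ≤ Fintype.card n) : ℝ :=
  hA.eigenvalues₀ ⟨Fintype.card n - 2, by omega⟩

/-- The Moore-Penrose inverse of a real symmetric matrix, obtained from an orthonormal
eigenbasis by inverting the nonzero eigenvalues (`0⁻¹ = 0`). -/
def moorePenroseInverse (hA : A.IsHermitian) : Matrix n n ℝ :=
  (hA.eigenvectorUnitary : Matrix n n ℝ) * diagonal (fun i => (hA.eigenvalues i)⁻¹) *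
    star (hA.eigenvectorUnitary : Matrix n n ℝ)

/-- The four Penrose equations, which determine the Moore-Penrose inverse uniquely. -/
theorem moorePenroseInverse_spec (hA : A.IsHermitian) :
    A * moorePenroseInverse hA * A = A ∧
    moorePenroseInverse hA * A * moorePenroseInverse hA = moorePenroseInverse hA ∧
    (A * moorePenroseInverse hA).IsHermitian ∧ (moorePenroseInverse hA * A).IsHermitian := by
  obtain ⟨U, d, hUU, hA', hX⟩ : ∃ (U : Matrix n n ℝ) (d : n → ℝ), star U * U = 1 ∧
      A = U * diagonal d * star U ∧
      moorePenroseInverse hA = U * diagonal (fun i => (d i)⁻¹) * star U := by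
    refine ⟨hA.eigenvectorUnitary, hA.eigenvalues, by simp, ?_, rfl⟩
    have h := hA.spectral_theorem
    rw [Unitary.conjStarAlgAut_apply] at h
    exact h
  have key : ∀ a b : n → ℝ, (U * diagonal a * star U) * (U * diagonal b * star U) =
      U * diagonal (fun i => a i * b i) * star U := by
    intro a b
    calc _ = U * diagonal a * (star U * U) * diagonal b * star U := by simp only [Matrix.mul_assoc]
      _ = _ := by rw [hUU, Matrix.mul_one, Matrix.mul_assoc U, diagonal_mul_diagonal]
  have herm : ∀ a : n → ℝ, (U * diagonal a * star U).IsHermitian := by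
    intro a
    simp [Matrix.IsHermitian, star_eq_conjTranspose, Matrix.mul_assoc]
  rw [hX]
  subst hA'
  simp only [key]
  refine ⟨?_, ?_, herm _, herm _⟩
  · congr 3; ext i; exact mul_inv_mul_cancel (d i)
  · congr 3; ext i; simpa using mul_inv_mul_cancel (d i)⁻¹

end Spectral

/-- A network of networks: `D ≥ 2` disjoint connected weighted graphs `sub i` (the subgraphs) on
finite node sets `V i`, together with a weighted graph `con` on the union of these node sets,
the connecting graph.  Each subgraph has a single connecting node `s i`: every connecting edge
joins the connecting nodes of two (necessarily different) subgraphs. -/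
structure NetworkOfNetworks (D : ℕ) (V : Fin D → Type*) where
  two_le : 2 ≤ D
  sub : (i : Fin D) → WeightedGraph (V i)
  sub_connected : ∀ i, (sub i).graph.Connected
  s : (i : Fin D) → V i
  con : WeightedGraph (Σ i, V i)
  con_adj : ∀ x y, con.graph.Adj x y → x.2 = s x.1 ∧ y.2 = s y.1

namespace NetworkOfNetworks

variable {D : ℕ} {V : Fin D → Type*}

/-- The inclusion of the connecting nodes, indexed by the subgraphs, into the set of all nodes. -/
def conNode (G : NetworkOfNetworks D V) (i : Fin D) : Σ i, V i := ⟨i, G.s i⟩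

/-- The connecting graph restricted to the connecting nodes. -/
def conHat (G : NetworkOfNetworks D V) : SimpleGraph (Fin D) := G.con.graph.comap G.conNode

theorem two_le_card_fin (G : NetworkOfNetworks D V) : 2 ≤ Fintype.card (Fin D) := by
  simpa using G.two_le

variable [∀ i, Fintype (V i)]

theorem two_le_card (G : NetworkOfNetworks D V) : 2 ≤ Fintype.card (Σ i, V i) :=
  G.two_le_card_fin.trans <| Fintype.card_le_of_injective G.conNode
    fun _ _ h => congrArg Sigma.fst h

variable [∀ i, DecidableEq (V i)]

/-- The block diagonal matrix of the Laplacians of the subgraphs. -/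
def Lsub (G : NetworkOfNetworks D V) : Matrix (Σ i, V i) (Σ i, V i) ℝ :=
  blockDiagonal' fun i => (G.sub i).laplacian

/-- The matrix `A = I - Lsub`. -/
def A (G : NetworkOfNetworks D V) : Matrix (Σ i, V i) (Σ i, V i) ℝ := 1 - G.Lsub

/-- The matrix `B`: the sum of `β w(r,s) b bᵀ` over the connecting edges. -/
def B (G : NetworkOfNetworks D V) (β : ℝ) : Matrix (Σ i, V i) (Σ i, V i) ℝ :=
  G.con.edgeMatrixSum β

/-- The expected weight matrix `A - p B`, where `p` is the probability that a connecting edge is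
active. -/
def expectedWeightMatrix (G : NetworkOfNetworks D V) (β p : ℝ) :
    Matrix (Σ i, V i) (Σ i, V i) ℝ :=
  G.A - p • G.B β

theorem expectedWeightMatrix_isHermitian (G : NetworkOfNetworks D V) (β p : ℝ) :
    (G.expectedWeightMatrix β p).IsHermitian := by
  have h1 : G.Lsub.IsHermitian := by
    unfold Lsub Matrix.IsHermitian
    rw [blockDiagonal'_conjTranspose]
    congr 1
    ext1 i
    exact (G.sub i).laplacian_isHermitian
  have h2 : (p • G.B β).IsHermitian := by
    have := G.con.edgeMatrixSum_isHermitian β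
    simp only [Matrix.IsHermitian, B] at this ⊢
    rw [conjTranspose_smul, this]
    simp
  exact (isHermitian_one.sub h1).sub h2

/-- The essential spectral radius of the expected weight matrix: its second largest eigenvalue. -/
def rhoEss (G : NetworkOfNetworks D V) (β p : ℝ) : ℝ :=
  secondLargestEigenvalue (G.expectedWeightMatrix_isHermitian β p) G.two_le_card

/-- The principal submatrix, on the connecting nodes, of the Laplacian of the connecting graph. -/
def LconHat (G : NetworkOfNetworks D V) : Matrix (Fin D) (Fin D) ℝ :=
  G.con.laplacian.submatrix G.conNode G.conNode

/-- The generalized Laplacian `R^(-1/2) LconHat R^(-1/2)`, where `R` is the diagonal matrix of the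
sizes of the subgraphs. -/
def Mhat (G : NetworkOfNetworks D V) : Matrix (Fin D) (Fin D) ℝ :=
  diagonal (fun i => (Real.sqrt (Fintype.card (V i)))⁻¹) * G.LconHat *
    diagonal (fun i => (Real.sqrt (Fintype.card (V i)))⁻¹)

theorem Mhat_isHermitian (G : NetworkOfNetworks D V) : G.Mhat.IsHermitian := by
  have h : G.LconHatᵀ = G.LconHat := by
    simpa [Matrix.IsHermitian, LconHat] using G.con.laplacian_isHermitian.submatrix G.conNode
  simp [Matrix.IsHermitian, Mhat, h, Matrix.mul_assoc]

/-- The second smallest eigenvalue of the generalized Laplacian. -/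
def lambda2 (G : NetworkOfNetworks D V) : ℝ :=
  secondSmallestEigenvalue G.Mhat_isHermitian G.two_le_card_fin

/-- The diagonal matrix with the entries `N_k · L_k†(s_k, s_k)`. -/
def Shat (G : NetworkOfNetworks D V) : Matrix (Fin D) (Fin D) ℝ :=
  diagonal fun k => (Fintype.card (V k) : ℝ) *
    moorePenroseInverse (G.sub k).laplacian_isHermitian (G.s k) (G.s k)

/-- `u` is a unit eigenvector of the generalized Laplacian for its second smallest eigenvalue. -/
def IsUnitEigenvector2 (G : NetworkOfNetworks D V) (u : Fin D → ℝ) : Prop :=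
  u ⬝ᵥ u = 1 ∧ G.Mhat *ᵥ u = G.lambda2 • u

end NetworkOfNetworks

end

/-! ### Weighted Laplacians: Dirichlet form, kernel, sum over edges. -/

namespace WeightedGraph

variable {V : Type*}

/-! Put t = pβ. By `rhoEss_spec`, 1 - ρ_ess is the minimum of x·Lsub x + t x·Lcon x over unit
vectors x with zero sum, Lcon being the Laplacian of the connecting graph on all nodes. Split x =
lift a + z, with `lift a` constant on each subgraph and z of zero sum on each. Since Lsub
annihilates `lift a`, and Lcon compressed to block-constant vectors is M = `Mhat`, the form becomes
z·Lsub z + t (a·M a + 2 z|_s·(R^{1/2} M a) + z·Lcon z).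

The corrector y of `exists_corrector` rewrites the cross term as 2t z·Lsub y. Completing the square
suggests z = -t y, with gain t² y·Lsub y = t² (M a)·S (M a); this is where S = `Shat` enters. What
remains is to minimize t a·M a - t² (M a)·S (M a) on the orthogonal complement of `sqrtSize`. At
leading order a is an eigenvector u for λ₂, and the second term is then -t² λ₂² u·S u. If λ₂ is
multiple, the minimum selects the u with the largest u·S u.

Both bounds hold up to O(p³). The trial vector lift u - t y gives `one_sub_rhoEss_le`. Conversely,
`exists_le_one_sub_rhoEss` uses the spectral gap of Lsub to control z, and
`exists_reduced_lower_bound` uses the gap of M above λ₂ to control the part of a outside the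
eigenspace. The simple case and the first-order expansion follow from the general second-order one;
`isLeast_lambda2` is a separate kernel argument. -/

theorem weight_self (G : WeightedGraph V) (r : V) : G.weight r r = 0 :=
  G.weight_eq_zero r r (G.graph.loopless.irrefl r)

theorem weight_nonneg (G : WeightedGraph V) (r s : V) : 0 ≤ G.weight r s := by
  by_cases h : G.graph.Adj r s
  · exact (G.weight_pos r s h).le
  · exact (G.weight_eq_zero r s h).ge

variable [DecidableEq V] [Fintype V]

theorem laplacian_mulVec (G : WeightedGraph V) (x : V → ℝ) (r : V) :
    (G.laplacian *ᵥ x) r = ∑ s, G.weight r s * (x r - x s) := by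
  have h : ∀ s, G.laplacian r s * x s =
      (if r = s then (∑ k, G.weight r k) * x s else 0) - G.weight r s * x s := by
    intro s
    by_cases h : r = s
    · subst h; simp [laplacian, G.weight_self]
    · simp [laplacian, h]
  simp only [mulVec, dotProduct, h, Finset.sum_sub_distrib, Finset.sum_ite_eq, Finset.mem_univ,
    if_true, mul_sub, Finset.sum_mul]

/-- Averaging over the exchange of r and s gives the Dirichlet form; the double sum meets each edge
in both directions, hence the factor 2. -/
theorem two_mul_dotProduct_laplacian_mulVec (G : WeightedGraph V) (x y : V → ℝ) :
    2 * (x ⬝ᵥ G.laplacian *ᵥ y) =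
      ∑ r, ∑ s, G.weight r s * ((x r - x s) * (y r - y s)) := by
  have h1 : x ⬝ᵥ G.laplacian *ᵥ y = ∑ r, ∑ s, G.weight r s * (x r * (y r - y s)) := by
    simp only [dotProduct, laplacian_mulVec, Finset.mul_sum]
    exact Finset.sum_congr rfl fun r _ => Finset.sum_congr rfl fun s _ => by ring
  have h2 : x ⬝ᵥ G.laplacian *ᵥ y = ∑ r, ∑ s, G.weight r s * (-x s * (y r - y s)) := by
    rw [h1, Finset.sum_comm]
    refine Finset.sum_congr rfl fun r _ => Finset.sum_congr rfl fun s _ => ?_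
    rw [G.weight_symm s r]; ring
  rw [two_mul]
  nth_rw 1 [h1]
  rw [h2, ← Finset.sum_add_distrib]
  refine Finset.sum_congr rfl fun r _ => ?_
  rw [← Finset.sum_add_distrib]
  exact Finset.sum_congr rfl fun s _ => by ring

theorem laplacian_posSemidef (G : WeightedGraph V) : G.laplacian.PosSemidef := by
  refine PosSemidef.of_dotProduct_mulVec_nonneg G.laplacian_isHermitian fun x => ?_
  have h := G.two_mul_dotProduct_laplacian_mulVec x x
  have : 0 ≤ ∑ r, ∑ s, G.weight r s * ((x r - x s) * (x r - x s)) :=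
    Finset.sum_nonneg fun r _ => Finset.sum_nonneg fun s _ =>
      mul_nonneg (G.weight_nonneg r s) (mul_self_nonneg _)
  simp only [star_trivial]
  linarith

theorem laplacian_mulVec_const (G : WeightedGraph V) (c : ℝ) :
    G.laplacian *ᵥ (fun _ => c) = 0 := by
  ext r; simp [laplacian_mulVec]

theorem eq_of_adj_of_laplacian_mulVec_eq_zero (G : WeightedGraph V) {x : V → ℝ}
    (hx : G.laplacian *ᵥ x = 0) {r s : V} (h : G.graph.Adj r s) : x r = x s := by
  have h1 := G.two_mul_dotProduct_laplacian_mulVec x x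
  rw [hx, dotProduct_zero, mul_zero] at h1
  have h0 : ∀ r s, 0 ≤ G.weight r s * ((x r - x s) * (x r - x s)) := fun r s =>
    mul_nonneg (G.weight_nonneg r s) (mul_self_nonneg _)
  have h2 := (Finset.sum_eq_zero_iff_of_nonneg
    fun r _ => Finset.sum_nonneg fun s _ => h0 r s).1 h1.symm r (Finset.mem_univ r)
  have h3 := (Finset.sum_eq_zero_iff_of_nonneg fun s _ => h0 r s).1 h2 s (Finset.mem_univ s)
  have h4 := mul_self_eq_zero.1 ((mul_eq_zero.1 h3).resolve_left (G.weight_pos r s h).ne')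
  exact sub_eq_zero.1 h4

theorem eq_of_laplacian_mulVec_eq_zero (G : WeightedGraph V) (hG : G.graph.Connected) {x : V → ℝ}
    (hx : G.laplacian *ᵥ x = 0) (r s : V) : x r = x s := by
  obtain ⟨w⟩ := hG.preconnected r s
  induction w with
  | nil => rfl
  | cons h _ ih => exact (G.eq_of_adj_of_laplacian_mulVec_eq_zero hx h).trans ih

theorem dotProduct_edgeVector (x : V → ℝ) (r s : V) : x ⬝ᵥ edgeVector r s = x r - x s := by
  simp [edgeVector, dotProduct_sub]

open Classical in
-- Compare bilinear forms, both doubled: each edge carries two darts, darts are ordered adjacent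
-- pairs, and the other pairs have weight 0. This replaces `B` by a multiple of a Laplacian.
theorem edgeMatrixSum_eq (G : WeightedGraph V) (β : ℝ) :
    G.edgeMatrixSum β = β • G.laplacian := by
  refine Matrix.ext_of_mulVec_single fun j => ?_
  refine dotProduct_eq _ _ fun x => ?_
  set y : V → ℝ := Pi.single j 1
  rw [dotProduct_comm, dotProduct_comm _ x, smul_mulVec, dotProduct_smul, smul_eq_mul]
  let F : Sym2 V → ℝ := fun e => x ⬝ᵥ G.edgeMatrix β e *ᵥ y
  have hF : ∀ r s, F s(r, s) = β * (G.weight r s * ((x r - x s) * (y r - y s))) := by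
    intro r s
    simp only [F, edgeMatrix, Sym2.lift_mk, smul_mulVec, dotProduct_smul, vecMulVec_mulVec,
      smul_eq_mul, dotProduct_edgeVector, dotProduct_comm (edgeVector r s) y,
      op_smul_eq_smul]
    ring
  have h1 : x ⬝ᵥ G.edgeMatrixSum β *ᵥ y = ∑ e ∈ G.graph.edgeFinset, F e := by
    simp only [edgeMatrixSum, F]
    rw [Matrix.sum_mulVec, dotProduct_sum]
  have h2 : 2 * ∑ e ∈ G.graph.edgeFinset, F e = ∑ d : G.graph.Dart, F d.edge := by
    rw [← Finset.sum_fiberwise_of_maps_to (s := Finset.univ) (t := G.graph.edgeFinset)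
      (g := fun d : G.graph.Dart => d.edge) (fun d _ => by simp [d.edge_mem]), Finset.mul_sum]
    refine Finset.sum_congr rfl fun e he => ?_
    rw [Finset.sum_congr rfl (g := fun _ => F e)
      (fun d hd => by rw [(Finset.mem_filter.1 hd).2]), Finset.sum_const,
      G.graph.dart_edge_fiber_card e (by simpa using he)]
    simp
  have h3 : ∑ d : G.graph.Dart, F d.edge = ∑ r, ∑ s, F s(r, s) := by
    rw [← Fintype.sum_prod_type']
    refine Finset.sum_of_injOn (fun d => d.toProd)
      (SimpleGraph.Dart.toProd_injective.injOn) (by simp) ?_ (fun _ _ => rfl)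
    rintro ⟨r, s⟩ - h
    have : ¬ G.graph.Adj r s := fun hrs => h ⟨⟨(r, s), hrs⟩, by simp, rfl⟩
    simp [hF, G.weight_eq_zero r s this]
  have h4 := G.two_mul_dotProduct_laplacian_mulVec x y
  simp only [hF] at h3
  simp only [← Finset.mul_sum] at h3
  rw [← h4] at h3
  rw [h1]
  linarith

end WeightedGraph

/-! ### Columns of the pseudoinverse of a Laplacian. -/

section Pinv

variable {n : Type*} [Fintype n] [DecidableEq n]

theorem moorePenroseInverse_isHermitian {A : Matrix n n ℝ} (hA : A.IsHermitian) :
    (moorePenroseInverse hA).IsHermitian := by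
  simp [moorePenroseInverse, Matrix.IsHermitian, star_eq_conjTranspose, Matrix.mul_assoc]

/-- The column at `s` of the Moore-Penrose inverse of the Laplacian of a connected graph. -/
theorem WeightedGraph.exists_column (G : WeightedGraph n) (hG : G.graph.Connected) (s : n) :
    ∃ y : n → ℝ, ∑ v, y v = 0 ∧
      (∀ z : n → ℝ, ∑ v, z v = 0 → z ⬝ᵥ G.laplacian *ᵥ y = z s) ∧
      y s = moorePenroseInverse G.laplacian_isHermitian s s := by
  set P := moorePenroseInverse G.laplacian_isHermitian
  obtain ⟨h1, h2, h3, h4⟩ := moorePenroseInverse_spec G.laplacian_isHermitian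
  have hP : Pᵀ = P := by simpa [Matrix.IsHermitian] using
    moorePenroseInverse_isHermitian G.laplacian_isHermitian
  have hL : G.laplacianᵀ = G.laplacian := by
    simpa [Matrix.IsHermitian] using G.laplacian_isHermitian
  have hcomm : G.laplacian * P = P * G.laplacian := by
    have : (G.laplacian * P)ᵀ = G.laplacian * P := by simpa [Matrix.IsHermitian] using h3
    rw [← this, transpose_mul, hP, hL]
  refine ⟨P *ᵥ Pi.single s 1, ?_, ?_, by simp⟩
  · have : (fun _ => (1 : ℝ)) ⬝ᵥ P *ᵥ Pi.single s 1 = 0 := by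
      have h5 : P = G.laplacian * (P * P) := by
        rw [← Matrix.mul_assoc, hcomm]; exact h2.symm
      have h6 : (fun _ => (1 : ℝ)) ᵥ* G.laplacian = 0 := by
        rw [← mulVec_transpose, hL]; exact G.laplacian_mulVec_const 1
      rw [h5, ← mulVec_mulVec, dotProduct_mulVec, h6, zero_dotProduct]
    simpa [dotProduct] using this
  · intro z hz
    -- With L the Laplacian, P its pseudoinverse and e_s the unit vector at s, L P e_s - e_s lies in
    -- the kernel of L. By connectedness it is constant, hence invisible to a z of zero sum.
    have h5 : G.laplacian *ᵥ (G.laplacian *ᵥ (P *ᵥ Pi.single s 1) - Pi.single s 1) = 0 := by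
      have h0 : G.laplacian * (G.laplacian * P) = G.laplacian := by
        rw [hcomm, ← Matrix.mul_assoc, h1]
      rw [mulVec_sub, mulVec_mulVec _ G.laplacian P, mulVec_mulVec, h0, sub_self]
    have h6 := fun v => G.eq_of_laplacian_mulVec_eq_zero hG h5 v s
    have h7 : z ⬝ᵥ (G.laplacian *ᵥ (P *ᵥ Pi.single s 1) - Pi.single s 1) = 0 := by
      rw [dotProduct, Finset.sum_congr rfl fun v _ => by rw [h6 v], ← Finset.sum_mul, hz, zero_mul]
    rw [dotProduct_sub, dotProduct_single, mul_one, sub_eq_zero] at h7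
    exact h7

end Pinv

/-! ### Spectral gaps and variational characterizations for symmetric matrices. -/

section SymmetricMatrix

variable {n : Type*} [Fintype n]

theorem dotProduct_mulVec_comm_of_symm {A : Matrix n n ℝ} (hA : Aᵀ = A) (x y : n → ℝ) :
    x ⬝ᵥ A *ᵥ y = y ⬝ᵥ A *ᵥ x := by
  rw [dotProduct_mulVec, ← mulVec_transpose, hA, dotProduct_comm]

theorem exists_abs_dotProduct_mulVec_le (A : Matrix n n ℝ) :
    ∃ K : ℝ, 0 ≤ K ∧ ∀ x y : n → ℝ,
      |x ⬝ᵥ A *ᵥ y| ≤ K * (√(x ⬝ᵥ x) * √(y ⬝ᵥ y)) := by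
  have hc : ∀ (x : n → ℝ) i, |x i| ≤ √(x ⬝ᵥ x) := by
    intro x i
    refine Real.abs_le_sqrt ?_
    rw [sq]
    exact Finset.single_le_sum (f := fun i => x i * x i) (fun j _ => mul_self_nonneg _)
      (Finset.mem_univ i)
  refine ⟨∑ i, ∑ j, |A i j|, Finset.sum_nonneg fun i _ => Finset.sum_nonneg fun j _ => abs_nonneg _,
    fun x y => ?_⟩
  simp only [Finset.sum_mul]
  rw [dotProduct]
  refine (Finset.abs_sum_le_sum_abs _ _).trans (Finset.sum_le_sum fun i _ => ?_)
  rw [mulVec, dotProduct, Finset.mul_sum]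
  refine (Finset.abs_sum_le_sum_abs _ _).trans (Finset.sum_le_sum fun j _ => ?_)
  rw [abs_mul, abs_mul, mul_left_comm]
  gcongr
  · exact hc x i
  · exact hc y j


theorem isCompact_unitSphere : IsCompact {x : n → ℝ | x ⬝ᵥ x = 1} := by
  refine (isCompact_univ_pi fun _ : n => isCompact_Icc (a := (-1 : ℝ)) (b := 1)).of_isClosed_subset
    (isClosed_eq (by fun_prop) continuous_const) fun x hx i _ => ?_
  have h : x i * x i ≤ 1 := (Finset.single_le_sum (f := fun i => x i * x i)
    (fun j _ => mul_self_nonneg _) (Finset.mem_univ i)).trans hx.le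
  exact abs_le.1 (abs_le_one_iff_mul_self_le_one.2 h)

theorem exists_unit_smul {x : n → ℝ} (hx : x ≠ 0) : ∃ c : ℝ, c ≠ 0 ∧ (c • x) ⬝ᵥ (c • x) = 1 := by
  have h0 : 0 < x ⬝ᵥ x := by
    refine lt_of_le_of_ne (Finset.sum_nonneg fun i _ => mul_self_nonneg (x i)) fun h => hx ?_
    exact dotProduct_self_eq_zero.1 h.symm
  have h1 : √(x ⬝ᵥ x) ≠ 0 := (Real.sqrt_pos.2 h0).ne'
  refine ⟨(√(x ⬝ᵥ x))⁻¹, inv_ne_zero h1, ?_⟩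
  rw [smul_dotProduct, dotProduct_smul, smul_eq_mul, smul_eq_mul]
  field_simp
  exact (Real.sq_sqrt h0.le).symm

/-- The spectral gap of a positive semidefinite matrix, on the orthogonal complement of its
kernel. -/
theorem Matrix.PosSemidef.exists_gap {A : Matrix n n ℝ} (hA : A.PosSemidef) :
    ∃ γ : ℝ, 0 < γ ∧ ∀ x : n → ℝ, (∀ y, A *ᵥ y = 0 → y ⬝ᵥ x = 0) →
      γ * (x ⬝ᵥ x) ≤ x ⬝ᵥ A *ᵥ x := by
  classical
  set K : Set (n → ℝ) := {x | x ⬝ᵥ x = 1} ∩ {x | ∀ y, A *ᵥ y = 0 → y ⬝ᵥ x = 0}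
  have hK : IsCompact K := by
    refine isCompact_unitSphere.inter_right ?_
    simp only [Set.ofPred_forall]
    exact isClosed_iInter fun y => isClosed_iInter fun _ =>
      isClosed_eq (by fun_prop) continuous_const
  have key : ∃ γ : ℝ, 0 < γ ∧ ∀ x ∈ K, γ ≤ x ⬝ᵥ A *ᵥ x := by
    rcases K.eq_empty_or_nonempty with h | h
    -- The kernel is the whole space; any positive constant will do.
    · exact ⟨1, one_pos, by simp [h]⟩
    · obtain ⟨x₀, hx₀, hmin⟩ := hK.exists_isMinOn h
        (f := fun x => x ⬝ᵥ A *ᵥ x) (Continuous.continuousOn (by fun_prop))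
      refine ⟨x₀ ⬝ᵥ A *ᵥ x₀, lt_of_le_of_ne ?_ fun h0 => ?_, fun x hx => hmin hx⟩
      · simpa using hA.dotProduct_mulVec_nonneg x₀
      · have h1 : A *ᵥ x₀ = 0 := (hA.dotProduct_mulVec_zero_iff x₀).1 (by simpa using h0.symm)
        have h2 : x₀ ⬝ᵥ x₀ = 1 := hx₀.1
        rw [hx₀.2 x₀ h1] at h2
        exact zero_ne_one h2
  obtain ⟨γ, hγ, hmin⟩ := key
  refine ⟨γ, hγ, fun x hx => ?_⟩
  by_cases h0 : x = 0
  · simp [h0]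
  obtain ⟨c, hc, h1⟩ := exists_unit_smul h0
  have h2 := hmin (c • x) ⟨h1, fun y hy => by rw [dotProduct_smul, hx y hy, smul_zero]⟩
  simp only [smul_dotProduct, dotProduct_smul, mulVec_smul, smul_eq_mul] at h1 h2
  have h3 : 0 < c * c := mul_self_pos.2 hc
  have h4 : γ * (c * (c * (x ⬝ᵥ x))) ≤ c * (c * (x ⬝ᵥ A *ᵥ x)) := by rw [h1]; linarith
  exact le_of_mul_le_mul_left (by linarith) h3

/-- An orthonormal eigenbasis of a real symmetric matrix. -/
structure IsEigenbasis {ι : Type*} [Fintype ι] [DecidableEq ι] (A : Matrix n n ℝ) (e : ι → ℝ)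
    (b : ι → n → ℝ) : Prop where
  orthonormal : ∀ i j, b i ⬝ᵥ b j = if i = j then 1 else 0
  parseval : ∀ x y, x ⬝ᵥ y = ∑ i, (b i ⬝ᵥ x) * (b i ⬝ᵥ y)
  mulVec_eq : ∀ i, A *ᵥ b i = e i • b i

theorem Matrix.IsHermitian.exists_isEigenbasis [DecidableEq n] {A : Matrix n n ℝ}
    (hA : A.IsHermitian) : ∃ b, IsEigenbasis A hA.eigenvalues₀ b := by
  let σ : Fin (Fintype.card n) ≃ n := Fintype.equivOfCardEq (Fintype.card_fin _)
  have hin : ∀ x y : EuclideanSpace ℝ n, x.ofLp ⬝ᵥ y.ofLp = inner ℝ x y := by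
    intro x y
    simp [EuclideanSpace.inner_eq_star_dotProduct, dotProduct_comm]
  refine ⟨fun i => (hA.eigenvectorBasis (σ i)).ofLp, fun i j => ?_, fun x y => ?_, fun i => ?_⟩
  · rw [hin, hA.eigenvectorBasis.inner_eq_ite]
    simp
  · have h := hA.eigenvectorBasis.sum_inner_mul_inner (WithLp.toLp 2 x) (WithLp.toLp 2 y)
    rw [← hin (WithLp.toLp 2 x) (WithLp.toLp 2 y)] at h
    rw [← h, ← σ.sum_comp]
    refine Finset.sum_congr rfl fun i _ => ?_
    rw [real_inner_comm, ← hin, ← hin]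
  · have h := hA.mulVec_eigenvectorBasis (σ i)
    have h1 : hA.eigenvalues (σ i) = hA.eigenvalues₀ i := by simp [IsHermitian.eigenvalues, σ]
    rw [h1] at h
    exact h

variable {ι : Type*} [Fintype ι] [DecidableEq ι]

theorem IsEigenbasis.dotProduct_mulVec {A : Matrix n n ℝ} {e : ι → ℝ} {b : ι → n → ℝ}
    (h : IsEigenbasis A e b) (hA : Aᵀ = A) (x : n → ℝ) :
    x ⬝ᵥ A *ᵥ x = ∑ i, e i * ((b i ⬝ᵥ x) * (b i ⬝ᵥ x)) := by
  rw [h.parseval]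
  refine Finset.sum_congr rfl fun i _ => ?_
  rw [dotProduct_mulVec_comm_of_symm hA, h.mulVec_eq, dotProduct_smul, smul_eq_mul,
    dotProduct_comm x]
  ring

/-- The variational characterization of the second smallest eigenvalue, for a known eigenvector `v`
of the smallest eigenvalue `c`. -/
theorem IsEigenbasis.second_smallest {A : Matrix n n ℝ} {e : ι → ℝ} {b : ι → n → ℝ}
    (h : IsEigenbasis A e b) (hA : Aᵀ = A) {i₀ i₁ : ι} (hne : i₀ ≠ i₁)
    (h01 : e i₀ ≤ e i₁) (h1 : ∀ i, i ≠ i₀ → e i₁ ≤ e i) {v : n → ℝ} (hv : v ≠ 0) {c : ℝ}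
    (hAv : A *ᵥ v = c • v) (hc : ∀ x, c * (x ⬝ᵥ x) ≤ x ⬝ᵥ A *ᵥ x) :
    (∀ x, v ⬝ᵥ x = 0 → e i₁ * (x ⬝ᵥ x) ≤ x ⬝ᵥ A *ᵥ x) ∧
      ∃ x, v ⬝ᵥ x = 0 ∧ x ⬝ᵥ x = 1 ∧ A *ᵥ x = e i₁ • x := by
  have hce : c ≤ e i₀ := by
    have := hc (b i₀)
    simpa [h.mulVec_eq, h.orthonormal] using this
  have hzero : ∀ i, e i ≠ c → b i ⬝ᵥ v = 0 := by
    intro i hi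
    have h2 : b i ⬝ᵥ A *ᵥ v = v ⬝ᵥ A *ᵥ b i := dotProduct_mulVec_comm_of_symm hA _ _
    rw [hAv, h.mulVec_eq, dotProduct_smul, dotProduct_smul, dotProduct_comm v, smul_eq_mul,
      smul_eq_mul] at h2
    have h3 : (e i - c) * (b i ⬝ᵥ v) = 0 := by linarith
    exact (mul_eq_zero.1 h3).resolve_left (sub_ne_zero.2 hi)
  have hvv : v ⬝ᵥ v ≠ 0 := fun h0 => hv (dotProduct_self_eq_zero.1 h0)
  -- If c is at least a double eigenvalue, some combination of `b i₀` and `b i₁` is orthogonal to v.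
  -- Otherwise v is a multiple of `b i₀`, and `b i₁` itself works.
  by_cases hlt : e i₁ = c
  · rw [hlt]
    refine ⟨fun x _ => hc x, ?_⟩
    have he0 : e i₀ = c := le_antisymm (h01.trans hlt.le) hce
    obtain ⟨y, hy0, hy1, hy2⟩ : ∃ y : n → ℝ, y ≠ 0 ∧ v ⬝ᵥ y = 0 ∧ A *ᵥ y = c • y := by
      by_cases hb : b i₁ ⬝ᵥ v = 0
      · refine ⟨b i₁, fun h0 => ?_, by rw [dotProduct_comm, hb], by rw [h.mulVec_eq, hlt]⟩
        have := h.orthonormal i₁ i₁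
        simp [h0] at this
      · refine ⟨(b i₁ ⬝ᵥ v) • b i₀ - (b i₀ ⬝ᵥ v) • b i₁, fun h0 => hb ?_, ?_, ?_⟩
        · have h2 : b i₀ ⬝ᵥ ((b i₁ ⬝ᵥ v) • b i₀ - (b i₀ ⬝ᵥ v) • b i₁) = 0 := by
            rw [h0, dotProduct_zero]
          simpa [dotProduct_sub, dotProduct_smul, h.orthonormal, hne] using h2
        · rw [dotProduct_sub, dotProduct_smul, dotProduct_smul, dotProduct_comm v,
            dotProduct_comm v, smul_eq_mul, smul_eq_mul]
          ring
        · rw [mulVec_sub, mulVec_smul, mulVec_smul, h.mulVec_eq, h.mulVec_eq, hlt, he0, smul_sub,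
            smul_comm c, smul_comm c]
    obtain ⟨t, -, ht⟩ := exists_unit_smul hy0
    exact ⟨t • y, by rw [dotProduct_smul, hy1, smul_zero], ht, by
      rw [mulVec_smul, hy2, smul_comm]⟩
  · have hlt' : c < e i₁ := lt_of_le_of_ne (hce.trans h01) (Ne.symm hlt)
    have hz : ∀ i, i ≠ i₀ → b i ⬝ᵥ v = 0 := fun i hi => hzero i (hlt'.trans_le (h1 i hi)).ne'
    have hvx : ∀ x, v ⬝ᵥ x = (b i₀ ⬝ᵥ v) * (b i₀ ⬝ᵥ x) := fun x => by
      rw [h.parseval v x]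
      exact Finset.sum_eq_single i₀ (fun i _ hi => by rw [hz i hi, zero_mul]) (by simp)
    have hb0 : b i₀ ⬝ᵥ v ≠ 0 := fun h0 => hvv (by rw [hvx v, h0, zero_mul])
    refine ⟨fun x hx => ?_, b i₁, by rw [dotProduct_comm]; exact hz i₁ hne.symm, by
      simp [h.orthonormal], h.mulVec_eq i₁⟩
    rw [hvx x] at hx
    have hx0 := (mul_eq_zero.1 hx).resolve_left hb0
    rw [h.dotProduct_mulVec hA, h.parseval x x, Finset.mul_sum]
    refine Finset.sum_le_sum fun i _ => ?_
    by_cases hi : i = i₀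
    · rw [hi, hx0]; simp
    · exact mul_le_mul_of_nonneg_right (h1 i hi) (mul_self_nonneg _)

variable [DecidableEq n]

theorem secondSmallestEigenvalue_spec {A : Matrix n n ℝ} (hA : A.IsHermitian)
    (hn : 2 ≤ Fintype.card n) {v : n → ℝ} (hv : v ≠ 0) {c : ℝ} (hAv : A *ᵥ v = c • v)
    (hc : ∀ x, c * (x ⬝ᵥ x) ≤ x ⬝ᵥ A *ᵥ x) :
    (∀ x, v ⬝ᵥ x = 0 → secondSmallestEigenvalue hA hn * (x ⬝ᵥ x) ≤ x ⬝ᵥ A *ᵥ x) ∧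
      ∃ x, v ⬝ᵥ x = 0 ∧ x ⬝ᵥ x = 1 ∧ A *ᵥ x = secondSmallestEigenvalue hA hn • x := by
  obtain ⟨b, hb⟩ := hA.exists_isEigenbasis
  have hT : Aᵀ = A := by simpa [Matrix.IsHermitian] using hA
  -- `eigenvalues₀` decreases, so the smallest eigenvalue has the last index, card - 1.
  refine hb.second_smallest hT (i₀ := ⟨Fintype.card n - 1, by omega⟩)
    (i₁ := ⟨Fintype.card n - 2, by omega⟩) (by simp; omega) ?_ ?_ hv hAv hc
  · exact hA.eigenvalues₀_antitone (by simp [Fin.le_def]; omega)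
  · intro i hi
    refine hA.eigenvalues₀_antitone ?_
    have := i.2
    simp [Fin.ext_iff, Fin.le_def] at hi ⊢
    omega

theorem secondLargestEigenvalue_spec {A : Matrix n n ℝ} (hA : A.IsHermitian)
    (hn : 2 ≤ Fintype.card n) {v : n → ℝ} (hv : v ≠ 0) {c : ℝ} (hAv : A *ᵥ v = c • v)
    (hc : ∀ x, x ⬝ᵥ A *ᵥ x ≤ c * (x ⬝ᵥ x)) :
    (∀ x, v ⬝ᵥ x = 0 → x ⬝ᵥ A *ᵥ x ≤ secondLargestEigenvalue hA hn * (x ⬝ᵥ x)) ∧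
      ∃ x, v ⬝ᵥ x = 0 ∧ x ⬝ᵥ x = 1 ∧ A *ᵥ x = secondLargestEigenvalue hA hn • x := by
  obtain ⟨b, hb⟩ := hA.exists_isEigenbasis
  have hT : Aᵀ = A := by simpa [Matrix.IsHermitian] using hA
  -- Negation reverses the order, so the same basis serves with indices 0 and 1.
  have hb' : IsEigenbasis (-A) (fun i => -hA.eigenvalues₀ i) b :=
    ⟨hb.orthonormal, hb.parseval, fun i => by rw [neg_mulVec, hb.mulVec_eq, neg_smul]⟩
  have h := hb'.second_smallest (by rw [transpose_neg, hT]) (i₀ := ⟨0, by omega⟩)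
    (i₁ := ⟨1, by omega⟩) (by simp) (neg_le_neg (hA.eigenvalues₀_antitone (by simp [Fin.le_def])))
    (fun i hi => neg_le_neg (hA.eigenvalues₀_antitone (by
      simp [Fin.ext_iff, Fin.le_def] at hi ⊢; omega))) hv (c := -c)
    (by rw [neg_mulVec, hAv, neg_smul])
    (fun x => by rw [neg_mulVec, dotProduct_neg]; linarith [hc x])
  simp only [neg_mulVec, dotProduct_neg, neg_mul, neg_le_neg_iff, neg_smul, neg_inj] at h
  exact h

end SymmetricMatrix

theorem Matrix.exists_add_ker_orthogonal {n : Type*} [Fintype n] [DecidableEq n]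
    (Q : Matrix n n ℝ) (a : n → ℝ) :
    ∃ e f : n → ℝ, a = e + f ∧ Q *ᵥ e = 0 ∧ ∀ y, Q *ᵥ y = 0 → y ⬝ᵥ f = 0 := by
  obtain ⟨e, he, f, hf, h⟩ := Submodule.exists_add_mem_mem_orthogonal
    (K := (Matrix.toEuclideanLin Q).ker) (WithLp.toLp 2 a)
  refine ⟨e.ofLp, f.ofLp, congrArg WithLp.ofLp h, ?_, fun y hy => ?_⟩
  · have := congrArg WithLp.ofLp (LinearMap.mem_ker.1 he)
    simpa using this
  · have h1 := (Submodule.mem_orthogonal _ _).1 hf (WithLp.toLp 2 y) (by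
      rw [LinearMap.mem_ker]
      simp [Matrix.toLpLin_apply, hy])
    rw [EuclideanSpace.inner_eq_star_dotProduct] at h1
    simpa [dotProduct_comm] using h1

/-! ### Block-constant vectors, and the network matrices acting on them. -/

namespace NetworkOfNetworks

variable {D : ℕ} {V : Fin D → Type*}

/-- The restriction of a vector to the connecting nodes. -/
def restrict (G : NetworkOfNetworks D V) (x : (Σ i, V i) → ℝ) : Fin D → ℝ := fun i => x (G.conNode i)

theorem restrict_surjective (G : NetworkOfNetworks D V) : Function.Surjective G.restrict :=
  fun w => ⟨fun v => w v.1, rfl⟩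

theorem con_weight_eq_zero_left (G : NetworkOfNetworks D V) {x : Σ i, V i} (hx : x.2 ≠ G.s x.1)
    (y : Σ i, V i) : G.con.weight x y = 0 :=
  G.con.weight_eq_zero _ _ fun h => hx (G.con_adj x y h).1

variable [∀ i, Fintype (V i)]

theorem sum_eq_sum_conNode (G : NetworkOfNetworks D V) (f : (Σ i, V i) → ℝ)
    (hf : ∀ x : Σ i, V i, x.2 ≠ G.s x.1 → f x = 0) : ∑ x, f x = ∑ i, f (G.conNode i) := by
  rw [Fintype.sum_sigma]
  refine Finset.sum_congr rfl fun i _ => ?_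
  exact Finset.sum_eq_single (G.s i) (fun v _ hv => hf ⟨i, v⟩ hv) (by simp)

/-- The square roots of the sizes of the subgraphs. -/
noncomputable def sqrtSize (_ : NetworkOfNetworks D V) (i : Fin D) : ℝ := √(Fintype.card (V i))

/-- The vector that is constant on every subgraph, with the coordinates `a` in the orthonormal
basis of the normalized indicator vectors. -/
noncomputable def lift (G : NetworkOfNetworks D V) (a : Fin D → ℝ) : (Σ i, V i) → ℝ :=
  fun v => (G.sqrtSize v.1)⁻¹ * a v.1

theorem card_pos (G : NetworkOfNetworks D V) (i : Fin D) : 0 < Fintype.card (V i) :=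
  Fintype.card_pos_iff.2 ⟨G.s i⟩

theorem sqrtSize_pos (G : NetworkOfNetworks D V) (i : Fin D) : 0 < G.sqrtSize i :=
  Real.sqrt_pos.2 (Nat.cast_pos.2 (G.card_pos i))

theorem sqrtSize_mul_self (G : NetworkOfNetworks D V) (i : Fin D) :
    G.sqrtSize i * G.sqrtSize i = Fintype.card (V i) :=
  Real.mul_self_sqrt (Nat.cast_nonneg _)

theorem inv_sqrtSize_mul_card (G : NetworkOfNetworks D V) (i : Fin D) :
    (G.sqrtSize i)⁻¹ * Fintype.card (V i) = G.sqrtSize i := by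
  rw [← G.sqrtSize_mul_self, inv_mul_cancel_left₀ (G.sqrtSize_pos i).ne']

theorem sqrtSize_ne_zero (G : NetworkOfNetworks D V) : G.sqrtSize ≠ 0 := by
  intro h
  have h1 := G.sqrtSize_pos ⟨0, by have := G.two_le; omega⟩
  rw [h] at h1
  exact lt_irrefl _ h1

theorem sum_lift (G : NetworkOfNetworks D V) (a : Fin D → ℝ) :
    ∑ v, G.lift a v = G.sqrtSize ⬝ᵥ a := by
  rw [Fintype.sum_sigma, dotProduct]
  refine Finset.sum_congr rfl fun i _ => ?_
  simp only [lift, Finset.sum_const, Finset.card_univ, nsmul_eq_mul]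
  rw [← mul_assoc, mul_comm (Fintype.card (V i) : ℝ), inv_sqrtSize_mul_card]

theorem lift_dotProduct_lift (G : NetworkOfNetworks D V) (a b : Fin D → ℝ) :
    G.lift a ⬝ᵥ G.lift b = a ⬝ᵥ b := by
  rw [dotProduct, Fintype.sum_sigma, dotProduct]
  refine Finset.sum_congr rfl fun i _ => ?_
  simp only [lift, Finset.sum_const, Finset.card_univ, nsmul_eq_mul]
  rw [← G.sqrtSize_mul_self]
  have := (G.sqrtSize_pos i).ne'
  field_simp

theorem lift_dotProduct_of_sum_eq_zero (G : NetworkOfNetworks D V) (a : Fin D → ℝ)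
    {z : (Σ i, V i) → ℝ} (hz : ∀ i, ∑ v, z ⟨i, v⟩ = 0) : G.lift a ⬝ᵥ z = 0 := by
  rw [dotProduct, Fintype.sum_sigma]
  refine Finset.sum_eq_zero fun i _ => ?_
  simp only [lift]
  rw [← Finset.mul_sum, hz, mul_zero]

theorem exists_eq_lift_add (G : NetworkOfNetworks D V) (x : (Σ i, V i) → ℝ) :
    ∃ a z, x = G.lift a + z ∧ ∀ i, ∑ v, z ⟨i, v⟩ = 0 := by
  refine ⟨fun i => (G.sqrtSize i)⁻¹ * ∑ v, x ⟨i, v⟩,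
    x - G.lift fun i => (G.sqrtSize i)⁻¹ * ∑ v, x ⟨i, v⟩, by simp, fun i => ?_⟩
  have h0 := (G.sqrtSize_pos i).ne'
  change ∑ v, (x ⟨i, v⟩ - (G.sqrtSize i)⁻¹ * ((G.sqrtSize i)⁻¹ * ∑ v, x ⟨i, v⟩)) = 0
  rw [Finset.sum_sub_distrib, Finset.sum_const, Finset.card_univ, nsmul_eq_mul,
    ← G.sqrtSize_mul_self]
  field_simp
  ring

theorem restrict_lift (G : NetworkOfNetworks D V) (a : Fin D → ℝ) (i : Fin D) :
    G.restrict (G.lift a) i = (G.sqrtSize i)⁻¹ * a i := rfl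

theorem lift_add_dotProduct_self (G : NetworkOfNetworks D V) (a : Fin D → ℝ)
    {z : (Σ i, V i) → ℝ} (hz : ∀ i, ∑ v, z ⟨i, v⟩ = 0) :
    (G.lift a + z) ⬝ᵥ (G.lift a + z) = a ⬝ᵥ a + z ⬝ᵥ z := by
  rw [add_dotProduct, dotProduct_add, dotProduct_add, dotProduct_comm z, lift_dotProduct_lift,
    G.lift_dotProduct_of_sum_eq_zero a hz]
  ring

theorem sum_lift_add (G : NetworkOfNetworks D V) (a : Fin D → ℝ)
    {z : (Σ i, V i) → ℝ} (hz : ∀ i, ∑ v, z ⟨i, v⟩ = 0) :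
    ∑ v, (G.lift a + z) v = G.sqrtSize ⬝ᵥ a := by
  simp only [Pi.add_apply]
  rw [Finset.sum_add_distrib, sum_lift, Fintype.sum_sigma z, Finset.sum_eq_zero fun i _ => hz i,
    add_zero]

variable [∀ i, DecidableEq (V i)]

theorem Lsub_mulVec_apply (G : NetworkOfNetworks D V) (x : (Σ i, V i) → ℝ) (i : Fin D) (v : V i) :
    (G.Lsub *ᵥ x) ⟨i, v⟩ = ((G.sub i).laplacian *ᵥ fun v => x ⟨i, v⟩) v := by
  rw [mulVec, dotProduct, Fintype.sum_sigma, Finset.sum_eq_single i]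
  · simp [Lsub, blockDiagonal'_apply_eq, mulVec, dotProduct]
  · intro j _ hj
    exact Finset.sum_eq_zero fun w _ => by rw [Lsub, blockDiagonal'_apply_ne _ _ _ hj.symm, zero_mul]
  · simp

theorem dotProduct_Lsub_mulVec (G : NetworkOfNetworks D V) (x y : (Σ i, V i) → ℝ) :
    x ⬝ᵥ G.Lsub *ᵥ y =
      ∑ i, (fun v => x ⟨i, v⟩) ⬝ᵥ (G.sub i).laplacian *ᵥ fun v => y ⟨i, v⟩ := by
  rw [dotProduct, Fintype.sum_sigma]
  refine Finset.sum_congr rfl fun i _ => ?_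
  simp only [Lsub_mulVec_apply]
  rfl

theorem Lsub_transpose (G : NetworkOfNetworks D V) : G.Lsubᵀ = G.Lsub := by
  rw [Lsub, blockDiagonal'_transpose]
  congr 1
  ext1 i
  simpa [Matrix.IsHermitian] using (G.sub i).laplacian_isHermitian

theorem Lsub_posSemidef (G : NetworkOfNetworks D V) : G.Lsub.PosSemidef := by
  refine PosSemidef.of_dotProduct_mulVec_nonneg
    (by simpa [Matrix.IsHermitian] using G.Lsub_transpose) fun x => ?_
  rw [star_trivial, dotProduct_Lsub_mulVec]
  exact Finset.sum_nonneg fun i _ => by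
    simpa using (G.sub i).laplacian_posSemidef.dotProduct_mulVec_nonneg fun v => x ⟨i, v⟩

theorem Lsub_mulVec_lift (G : NetworkOfNetworks D V) (a : Fin D → ℝ) :
    G.Lsub *ᵥ G.lift a = 0 := by
  ext ⟨i, v⟩
  rw [Lsub_mulVec_apply]
  exact congrFun ((G.sub i).laplacian_mulVec_const ((G.sqrtSize i)⁻¹ * a i)) v

/-- The spectral gap of the Laplacian of the disjoint union of the subgraphs. -/
theorem exists_gap_Lsub (G : NetworkOfNetworks D V) :
    ∃ γ : ℝ, 0 < γ ∧ ∀ z : (Σ i, V i) → ℝ, (∀ i, ∑ v, z ⟨i, v⟩ = 0) →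
      γ * (z ⬝ᵥ z) ≤ z ⬝ᵥ G.Lsub *ᵥ z := by
  obtain ⟨γ, hγ, h⟩ := G.Lsub_posSemidef.exists_gap
  refine ⟨γ, hγ, fun z hz => h z fun y hy => ?_⟩
  have h1 : ∀ i v, y ⟨i, v⟩ = y ⟨i, G.s i⟩ := fun i v => by
    refine (G.sub i).eq_of_laplacian_mulVec_eq_zero (G.sub_connected i)
      (x := fun v => y ⟨i, v⟩) ?_ v (G.s i)
    ext v
    rw [← Lsub_mulVec_apply, hy]
    rfl
  rw [dotProduct, Fintype.sum_sigma]
  refine Finset.sum_eq_zero fun i _ => ?_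
  simp only [h1]
  rw [← Finset.mul_sum, hz, mul_zero]

theorem con_laplacian_apply_eq_zero_left (G : NetworkOfNetworks D V) {x : Σ i, V i}
    (hx : x.2 ≠ G.s x.1) (y : Σ i, V i) : G.con.laplacian x y = 0 := by
  simp [WeightedGraph.laplacian, G.con_weight_eq_zero_left hx]

theorem con_laplacian_apply_eq_zero_right (G : NetworkOfNetworks D V) (x : Σ i, V i)
    {y : Σ i, V i} (hy : y.2 ≠ G.s y.1) : G.con.laplacian x y = 0 := by
  have h := G.con.laplacian_isHermitian.apply x y
  rw [star_trivial] at h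
  rw [← h, G.con_laplacian_apply_eq_zero_left hy]

/-- Rows and columns of the connecting Laplacian vanish away from the connecting nodes. -/
theorem dotProduct_con_laplacian_mulVec (G : NetworkOfNetworks D V) (x y : (Σ i, V i) → ℝ) :
    x ⬝ᵥ G.con.laplacian *ᵥ y = G.restrict x ⬝ᵥ G.LconHat *ᵥ G.restrict y := by
  have h : ∀ v, (G.con.laplacian *ᵥ y) v = ∑ j, G.con.laplacian v (G.conNode j) * y (G.conNode j) :=
    fun v => G.sum_eq_sum_conNode (fun w => G.con.laplacian v w * y w)
      fun w hw => by rw [G.con_laplacian_apply_eq_zero_right v hw, zero_mul]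
  refine (G.sum_eq_sum_conNode (fun v => x v * (G.con.laplacian *ᵥ y) v) fun v hv => ?_).trans ?_
  · rw [h]
    simp [G.con_laplacian_apply_eq_zero_left hv]
  · simp only [h]
    rfl

theorem LconHat_mulVec_const (G : NetworkOfNetworks D V) (c : ℝ) :
    G.LconHat *ᵥ (fun _ => c) = 0 := by
  refine dotProduct_eq_zero _ fun w => ?_
  obtain ⟨x, rfl⟩ := G.restrict_surjective w
  have h := G.dotProduct_con_laplacian_mulVec x fun _ => c
  rw [G.con.laplacian_mulVec_const, dotProduct_zero] at h
  rw [dotProduct_comm]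
  exact h.symm

theorem Mhat_mulVec_apply (G : NetworkOfNetworks D V) (a : Fin D → ℝ) (i : Fin D) :
    (G.Mhat *ᵥ a) i = (G.sqrtSize i)⁻¹ * (G.LconHat *ᵥ G.restrict (G.lift a)) i := by
  have h : diagonal (fun i => (√(Fintype.card (V i) : ℝ))⁻¹) *ᵥ a = G.restrict (G.lift a) := by
    ext j
    rw [mulVec_diagonal]
    rfl
  rw [Mhat, ← mulVec_mulVec, ← mulVec_mulVec, h, mulVec_diagonal]
  rfl

theorem LconHat_mulVec_restrict_lift (G : NetworkOfNetworks D V) (a : Fin D → ℝ) :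
    G.LconHat *ᵥ G.restrict (G.lift a) = G.sqrtSize * G.Mhat *ᵥ a := by
  ext i
  rw [Pi.mul_apply, Mhat_mulVec_apply, mul_inv_cancel_left₀ (G.sqrtSize_pos i).ne']

theorem Mhat_mulVec_sqrtSize (G : NetworkOfNetworks D V) : G.Mhat *ᵥ G.sqrtSize = 0 := by
  have h : G.restrict (G.lift G.sqrtSize) = fun _ => 1 := by
    ext i
    rw [restrict_lift, inv_mul_cancel₀ (G.sqrtSize_pos i).ne']
  ext i
  rw [Mhat_mulVec_apply, h, LconHat_mulVec_const]
  simp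

/-- The normalization in `lift` supplies the two factors R^{-1/2}. Hence the first-order
perturbation on the kernel of `Lsub` is governed by `Mhat`. -/
theorem lift_dotProduct_con_laplacian_mulVec_lift (G : NetworkOfNetworks D V) (a b : Fin D → ℝ) :
    G.lift a ⬝ᵥ G.con.laplacian *ᵥ G.lift b = a ⬝ᵥ G.Mhat *ᵥ b := by
  rw [dotProduct_con_laplacian_mulVec, LconHat_mulVec_restrict_lift]
  refine Finset.sum_congr rfl fun i _ => ?_
  have := (G.sqrtSize_pos i).ne'
  rw [restrict_lift, Pi.mul_apply]
  field_simp

theorem Mhat_transpose (G : NetworkOfNetworks D V) : G.Mhatᵀ = G.Mhat := by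
  simpa [Matrix.IsHermitian] using G.Mhat_isHermitian

theorem dotProduct_Mhat_mulVec_nonneg (G : NetworkOfNetworks D V) (a : Fin D → ℝ) :
    0 ≤ a ⬝ᵥ G.Mhat *ᵥ a := by
  rw [← lift_dotProduct_con_laplacian_mulVec_lift]
  simpa using G.con.laplacian_posSemidef.dotProduct_mulVec_nonneg (G.lift a)

/-- `sqrtSize` holds the coordinates of the all-ones vector and is a null vector of the positive
semidefinite `Mhat`, so the variational characterization applies with c = 0. -/
theorem lambda2_spec (G : NetworkOfNetworks D V) :
    (∀ a, G.sqrtSize ⬝ᵥ a = 0 → G.lambda2 * (a ⬝ᵥ a) ≤ a ⬝ᵥ G.Mhat *ᵥ a) ∧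
      ∃ u, G.sqrtSize ⬝ᵥ u = 0 ∧ G.IsUnitEigenvector2 u :=
  secondSmallestEigenvalue_spec G.Mhat_isHermitian G.two_le_card_fin G.sqrtSize_ne_zero (c := 0)
    (by rw [Mhat_mulVec_sqrtSize, zero_smul])
    (fun a => by rw [zero_mul]; exact G.dotProduct_Mhat_mulVec_nonneg a)

theorem lambda2_nonneg (G : NetworkOfNetworks D V) : 0 ≤ G.lambda2 := by
  obtain ⟨u, -, hu, hM⟩ := G.lambda2_spec.2
  have := G.dotProduct_Mhat_mulVec_nonneg u
  rwa [hM, dotProduct_smul, hu, smul_eq_mul, mul_one] at this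

theorem sqrtSize_dotProduct_eigenvector (G : NetworkOfNetworks D V) {μ : ℝ} (hμ : μ ≠ 0)
    {u : Fin D → ℝ} (hu : G.Mhat *ᵥ u = μ • u) : G.sqrtSize ⬝ᵥ u = 0 := by
  have h := dotProduct_mulVec_comm_of_symm G.Mhat_transpose G.sqrtSize u
  rw [hu, Mhat_mulVec_sqrtSize, dotProduct_zero, dotProduct_smul, smul_eq_mul] at h
  exact (mul_eq_zero.1 h).resolve_left hμ

/-- `1 - rhoEss` is the minimum of the Rayleigh quotient of `I - Ā = Lsub + p B` on the orthogonal
complement of the constants. -/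
theorem rhoEss_spec (G : NetworkOfNetworks D V) {β p : ℝ} (hβ : 0 ≤ β) (hp : 0 ≤ p) :
    (∀ x : (Σ i, V i) → ℝ, ∑ v, x v = 0 → (1 - G.rhoEss β p) * (x ⬝ᵥ x) ≤
      x ⬝ᵥ G.Lsub *ᵥ x + p * β * (x ⬝ᵥ G.con.laplacian *ᵥ x)) ∧
    ∃ x : (Σ i, V i) → ℝ, ∑ v, x v = 0 ∧ x ⬝ᵥ x = 1 ∧ 1 - G.rhoEss β p =
      x ⬝ᵥ G.Lsub *ᵥ x + p * β * (x ⬝ᵥ G.con.laplacian *ᵥ x) := by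
  have hE : ∀ x, G.expectedWeightMatrix β p *ᵥ x =
      x - G.Lsub *ᵥ x - (p * β) • G.con.laplacian *ᵥ x := fun x => by
    rw [expectedWeightMatrix, A, B, WeightedGraph.edgeMatrixSum_eq, sub_mulVec, sub_mulVec,
      one_mulVec, smul_mulVec, smul_mulVec, smul_smul]
  have hq : ∀ x, x ⬝ᵥ G.expectedWeightMatrix β p *ᵥ x =
      x ⬝ᵥ x - (x ⬝ᵥ G.Lsub *ᵥ x + p * β * (x ⬝ᵥ G.con.laplacian *ᵥ x)) := fun x => by
    rw [hE, dotProduct_sub, dotProduct_sub, dotProduct_smul, smul_eq_mul]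
    ring
  have hv : (fun _ : Σ i, V i => (1 : ℝ)) ≠ 0 := fun h =>
    one_ne_zero (congrFun h (G.conNode ⟨0, by have := G.two_le; omega⟩))
  have h1 : ∀ x : (Σ i, V i) → ℝ, (fun _ : Σ i, V i => (1 : ℝ)) ⬝ᵥ x = ∑ v, x v := fun x => by
    simp [dotProduct]
  -- The all-ones vector has eigenvalue 1, the largest one because both Laplacians are positive
  -- semidefinite and pβ ≥ 0.
  obtain ⟨h2, x, h3, h4, h5⟩ := secondLargestEigenvalue_spec
    (G.expectedWeightMatrix_isHermitian β p) G.two_le_card hv (c := 1) (by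
      have h6 : G.Lsub *ᵥ (fun _ => 1) = 0 := by
        ext ⟨i, v⟩
        rw [Lsub_mulVec_apply]
        exact congrFun ((G.sub i).laplacian_mulVec_const _) v
      rw [hE, h6, G.con.laplacian_mulVec_const]
      simp) (fun x => by
      have h6 : 0 ≤ x ⬝ᵥ G.Lsub *ᵥ x := by simpa using G.Lsub_posSemidef.dotProduct_mulVec_nonneg x
      have h7 : 0 ≤ x ⬝ᵥ G.con.laplacian *ᵥ x := by
        simpa using G.con.laplacian_posSemidef.dotProduct_mulVec_nonneg x
      rw [hq]
      nlinarith [mul_nonneg (mul_nonneg hp hβ) h7])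
  refine ⟨fun y hy => ?_, x, by rw [← h1, h3], h4, ?_⟩
  · have := h2 y (by rw [h1, hy])
    rw [hq] at this
    rw [rhoEss]
    linarith
  · have h6 := hq x
    rw [h5, dotProduct_smul, h4, smul_eq_mul, mul_one] at h6
    rw [rhoEss]
    linarith

theorem rhoEss_le_one (G : NetworkOfNetworks D V) {β p : ℝ} (hβ : 0 ≤ β) (hp : 0 ≤ p) :
    G.rhoEss β p ≤ 1 := by
  obtain ⟨x, -, -, h⟩ := (G.rhoEss_spec hβ hp).2
  have h6 : 0 ≤ x ⬝ᵥ G.Lsub *ᵥ x := by simpa using G.Lsub_posSemidef.dotProduct_mulVec_nonneg x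
  have h7 : 0 ≤ x ⬝ᵥ G.con.laplacian *ᵥ x := by
    simpa using G.con.laplacian_posSemidef.dotProduct_mulVec_nonneg x
  nlinarith [mul_nonneg (mul_nonneg hp hβ) h7]

end NetworkOfNetworks

/-! ### Second-order estimates for the Rayleigh quotient. -/

namespace NetworkOfNetworks

variable {D : ℕ} {V : Fin D → Type*} [∀ i, Fintype (V i)] [∀ i, DecidableEq (V i)]

/-- The corrector: the vector `y = Lsub† C R^(1/2) m`, where `C` embeds the connecting nodes. -/
theorem exists_corrector (G : NetworkOfNetworks D V) (m : Fin D → ℝ) :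
    ∃ y : (Σ i, V i) → ℝ, (∀ i, ∑ v, y ⟨i, v⟩ = 0) ∧
      (∀ z : (Σ i, V i) → ℝ, (∀ i, ∑ v, z ⟨i, v⟩ = 0) →
        z ⬝ᵥ G.Lsub *ᵥ y = G.restrict z ⬝ᵥ (G.sqrtSize * m)) ∧
      y ⬝ᵥ G.Lsub *ᵥ y = m ⬝ᵥ G.Shat *ᵥ m := by
  choose c hc0 hc1 hc2 using fun i => (G.sub i).exists_column (G.sub_connected i) (G.s i)
  have h0 : ∀ i, ∑ v, (fun x : Σ i, V i => (G.sqrtSize * m) x.1 * c x.1 x.2) ⟨i, v⟩ = 0 :=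
    fun i => by
      change ∑ v, (G.sqrtSize * m) i * c i v = 0
      rw [← Finset.mul_sum, hc0, mul_zero]
  have h1 : ∀ z : (Σ i, V i) → ℝ, (∀ i, ∑ v, z ⟨i, v⟩ = 0) →
      z ⬝ᵥ G.Lsub *ᵥ (fun x => (G.sqrtSize * m) x.1 * c x.1 x.2) =
        G.restrict z ⬝ᵥ (G.sqrtSize * m) := by
    intro z hz
    rw [dotProduct_Lsub_mulVec, dotProduct]
    refine Finset.sum_congr rfl fun i _ => ?_
    have h2 : (fun v => (G.sqrtSize * m) i * c i v) = (G.sqrtSize * m) i • c i := rfl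
    rw [h2, mulVec_smul, dotProduct_smul, hc1 i _ (hz i), smul_eq_mul, mul_comm]
    rfl
  refine ⟨_, h0, h1, ?_⟩
  -- Test the corrector against itself: its value at the k-th connecting node is √N_k m_k L_k†(s_k,
  -- s_k), and pairing with √N_k m_k produces the entry of `Shat`.
  rw [h1 _ h0, dotProduct, dotProduct]
  refine Finset.sum_congr rfl fun i _ => ?_
  rw [Shat, mulVec_diagonal, ← hc2, ← G.sqrtSize_mul_self]
  simp only [restrict, conNode, Pi.mul_apply]
  ring

theorem dotProduct_Shat_mulVec_nonneg (G : NetworkOfNetworks D V) (m : Fin D → ℝ) :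
    0 ≤ m ⬝ᵥ G.Shat *ᵥ m := by
  obtain ⟨y, -, -, h⟩ := G.exists_corrector m
  rw [← h]
  simpa using G.Lsub_posSemidef.dotProduct_mulVec_nonneg y

theorem dotProduct_Lsub_mulVec_lift_add (G : NetworkOfNetworks D V) (a : Fin D → ℝ)
    (z : (Σ i, V i) → ℝ) :
    (G.lift a + z) ⬝ᵥ G.Lsub *ᵥ (G.lift a + z) = z ⬝ᵥ G.Lsub *ᵥ z := by
  rw [mulVec_add, Lsub_mulVec_lift, zero_add, add_dotProduct,
    dotProduct_mulVec_comm_of_symm G.Lsub_transpose (G.lift a), Lsub_mulVec_lift, dotProduct_zero,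
    zero_add]

/-- The cross term is put in the form that `exists_corrector` represents, with m = `Mhat` a. -/
theorem dotProduct_con_laplacian_mulVec_lift_add (G : NetworkOfNetworks D V) (a : Fin D → ℝ)
    (z : (Σ i, V i) → ℝ) :
    (G.lift a + z) ⬝ᵥ G.con.laplacian *ᵥ (G.lift a + z) =
      a ⬝ᵥ G.Mhat *ᵥ a + 2 * (G.restrict z ⬝ᵥ (G.sqrtSize * G.Mhat *ᵥ a)) +
        z ⬝ᵥ G.con.laplacian *ᵥ z := by
  have hT : G.con.laplacianᵀ = G.con.laplacian := by
    simpa [Matrix.IsHermitian] using G.con.laplacian_isHermitian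
  rw [mulVec_add, add_dotProduct, dotProduct_add, dotProduct_add,
    dotProduct_mulVec_comm_of_symm hT (G.lift a) z, lift_dotProduct_con_laplacian_mulVec_lift,
    G.dotProduct_con_laplacian_mulVec z (G.lift a), LconHat_mulVec_restrict_lift]
  ring

/-- Test the Rayleigh quotient at lift u - pβ y, y being the corrector for `Mhat` u; the only cubic
term is the connecting energy of y. -/
theorem one_sub_rhoEss_le (G : NetworkOfNetworks D V) {β : ℝ} (hβ : 0 ≤ β) {u : Fin D → ℝ}
    (hr : G.sqrtSize ⬝ᵥ u = 0) (hu : G.IsUnitEigenvector2 u) :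
    ∃ C : ℝ, ∀ p : ℝ, 0 ≤ p → 1 - G.rhoEss β p ≤
      p * β * G.lambda2 - (p * β) ^ 2 * (G.lambda2 ^ 2 * (u ⬝ᵥ G.Shat *ᵥ u)) + C * p ^ 3 := by
  obtain ⟨y, hy0, hy1, hy2⟩ := G.exists_corrector (G.Mhat *ᵥ u)
  have hS : y ⬝ᵥ G.Lsub *ᵥ y = G.lambda2 ^ 2 * (u ⬝ᵥ G.Shat *ᵥ u) := by
    rw [hy2, hu.2, mulVec_smul, dotProduct_smul, smul_dotProduct, smul_eq_mul, smul_eq_mul]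
    ring
  refine ⟨β ^ 3 * (y ⬝ᵥ G.con.laplacian *ᵥ y), fun p hp => ?_⟩
  have hz : ∀ i, ∑ v, ((-(p * β)) • y) ⟨i, v⟩ = 0 := fun i => by
    simp only [Pi.smul_apply, smul_eq_mul]
    rw [← Finset.mul_sum, hy0, mul_zero]
  have h := (G.rhoEss_spec hβ hp).1 (G.lift u + (-(p * β)) • y) (by rw [G.sum_lift_add u hz, hr])
  rw [G.lift_add_dotProduct_self u hz, dotProduct_Lsub_mulVec_lift_add,
    dotProduct_con_laplacian_mulVec_lift_add, ← hy1 _ hz] at h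
  simp only [mulVec_smul, dotProduct_smul, smul_dotProduct, smul_eq_mul, hu.1, hS] at h
  rw [hu.2, dotProduct_smul, hu.1, smul_eq_mul] at h
  -- The trial vector is longer than a unit vector; as 1 - ρ_ess ≥ 0, the excess can be dropped.
  have h0 : 0 ≤ (1 - G.rhoEss β p) * (-(p * β) * (-(p * β) * (y ⬝ᵥ y))) := by
    refine mul_nonneg (sub_nonneg.2 (G.rhoEss_le_one hβ hp)) ?_
    have : 0 ≤ y ⬝ᵥ y := Finset.sum_nonneg fun i _ => mul_self_nonneg (y i)
    have := mul_nonneg (sq_nonneg (p * β)) this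
    linarith
  linarith

/-- The spectral gap of the generalized Laplacian above its second smallest eigenvalue. -/
theorem exists_gap_Mhat (G : NetworkOfNetworks D V) :
    ∃ δ : ℝ, 0 < δ ∧ ∀ a : Fin D → ℝ, G.sqrtSize ⬝ᵥ a = 0 → ∃ e f : Fin D → ℝ, a = e + f ∧
      e ⬝ᵥ f = 0 ∧ G.Mhat *ᵥ e = G.lambda2 • e ∧
      δ * (f ⬝ᵥ f) ≤ a ⬝ᵥ G.Mhat *ᵥ a - G.lambda2 * (a ⬝ᵥ a) := by
  set r := G.sqrtSize
  have hrr : r ⬝ᵥ r ≠ 0 := fun h => G.sqrtSize_ne_zero (dotProduct_self_eq_zero.1 h)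
  -- κ is chosen so that Q r = 0. As Q equals M - λ₂ on the complement of r, it is positive
  -- semidefinite, and its gap there is the one sought.
  set κ : ℝ := G.lambda2 / (r ⬝ᵥ r)
  set Q : Matrix (Fin D) (Fin D) ℝ := G.Mhat - G.lambda2 • 1 + κ • vecMulVec r r
  have hQ : ∀ x, Q *ᵥ x = G.Mhat *ᵥ x - G.lambda2 • x + (κ * (r ⬝ᵥ x)) • r := fun x => by
    simp only [Q, add_mulVec, sub_mulVec, smul_mulVec, one_mulVec, vecMulVec_mulVec,
      op_smul_eq_smul, smul_smul]
  have hQr : Q *ᵥ r = 0 := by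
    rw [hQ, Mhat_mulVec_sqrtSize, div_mul_cancel₀ _ hrr]
    simp
  have hQT : Qᵀ = Q := by
    simp [Q, Mhat_transpose, transpose_vecMulVec]
  have hQ0 : ∀ x, r ⬝ᵥ x = 0 → Q *ᵥ x = G.Mhat *ᵥ x - G.lambda2 • x := fun x hx => by
    rw [hQ, hx]; simp
  have hdec : ∀ x, ∃ (t : ℝ) (x' : Fin D → ℝ), r ⬝ᵥ x' = 0 ∧ x = x' + t • r := fun x =>
    ⟨(r ⬝ᵥ x) / (r ⬝ᵥ r), x - ((r ⬝ᵥ x) / (r ⬝ᵥ r)) • r, by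
      rw [dotProduct_sub, dotProduct_smul, smul_eq_mul, div_mul_cancel₀ _ hrr, sub_self], by simp⟩
  have hps : Q.PosSemidef := by
    refine PosSemidef.of_dotProduct_mulVec_nonneg
      (by simpa [Matrix.IsHermitian] using hQT) fun x => ?_
    obtain ⟨t, x', hx', rfl⟩ := hdec x
    have h1 := G.lambda2_spec.1 x' hx'
    rw [star_trivial, mulVec_add, mulVec_smul, hQr, smul_zero, add_zero, add_dotProduct,
      smul_dotProduct, dotProduct_mulVec_comm_of_symm hQT r, hQr, dotProduct_zero, smul_zero,
      add_zero, hQ0 x' hx', dotProduct_sub, dotProduct_smul, smul_eq_mul]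
    linarith
  obtain ⟨δ, hδ, hgap⟩ := hps.exists_gap
  refine ⟨δ, hδ, fun a ha => ?_⟩
  obtain ⟨e, f, rfl, he, hf⟩ := Q.exists_add_ker_orthogonal a
  have hrf : r ⬝ᵥ f = 0 := hf r hQr
  have hre : r ⬝ᵥ e = 0 := by rwa [dotProduct_add, hrf, add_zero] at ha
  refine ⟨e, f, rfl, hf e he, ?_, ?_⟩
  · rw [hQ0 e hre] at he
    exact sub_eq_zero.1 he
  · have h1 := hgap f hf
    have h2 : (e + f) ⬝ᵥ Q *ᵥ (e + f) = f ⬝ᵥ Q *ᵥ f := by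
      rw [mulVec_add, he, zero_add, add_dotProduct, dotProduct_mulVec_comm_of_symm hQT e, he,
        dotProduct_zero, zero_add]
    rw [hQ0 _ ha, dotProduct_sub, dotProduct_smul, smul_eq_mul] at h2
    linarith

/-- Homogeneity: the form at e is |e|² times its value at a unit eigenvector, and σ ≥ 0 absorbs the
factor |e|² ≤ 1. -/
theorem lambda2_sq_mul_le (G : NetworkOfNetworks D V) {σ : ℝ} (hσ : 0 ≤ σ)
    (hmax : ∀ v : Fin D → ℝ, G.IsUnitEigenvector2 v → v ⬝ᵥ G.Shat *ᵥ v ≤ σ) {e : Fin D → ℝ}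
    (he : G.Mhat *ᵥ e = G.lambda2 • e) (he1 : e ⬝ᵥ e ≤ 1) : e ⬝ᵥ G.Shat *ᵥ e ≤ σ := by
  by_cases h0 : e = 0
  · simpa [h0] using hσ
  obtain ⟨c, hc, h1⟩ := exists_unit_smul h0
  have h2 := hmax (c • e) ⟨h1, by rw [mulVec_smul, he, smul_comm]⟩
  simp only [mulVec_smul, smul_dotProduct, dotProduct_smul, smul_eq_mul] at h1 h2
  have h3 : 0 ≤ e ⬝ᵥ e := Finset.sum_nonneg fun i _ => mul_self_nonneg (e i)
  have h4 : e ⬝ᵥ e * (c * (c * (e ⬝ᵥ G.Shat *ᵥ e))) ≤ e ⬝ᵥ e * σ :=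
    mul_le_mul_of_nonneg_left h2 h3
  have h5 : e ⬝ᵥ e * (c * (c * (e ⬝ᵥ G.Shat *ᵥ e))) = e ⬝ᵥ G.Shat *ᵥ e := by
    linear_combination (e ⬝ᵥ G.Shat *ᵥ e) * h1
  nlinarith

/-- The effect of the second order term on the minimization over the block constant vectors. -/
theorem exists_reduced_lower_bound (G : NetworkOfNetworks D V) {σ : ℝ} (hσ : 0 ≤ σ)
    (hmax : ∀ v : Fin D → ℝ, G.IsUnitEigenvector2 v → v ⬝ᵥ G.Shat *ᵥ v ≤ σ) :
    ∃ K H : ℝ, 0 ≤ H ∧ ∀ a : Fin D → ℝ, G.sqrtSize ⬝ᵥ a = 0 → a ⬝ᵥ a ≤ 1 →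
      (G.Mhat *ᵥ a) ⬝ᵥ G.Shat *ᵥ (G.Mhat *ᵥ a) ≤ H ∧
      ∀ t : ℝ, 0 ≤ t → -(t ^ 2 * (G.lambda2 ^ 2 * σ)) - K * t ^ 3 ≤
        t * (a ⬝ᵥ G.Mhat *ᵥ a - G.lambda2 * (a ⬝ᵥ a)) -
          t ^ 2 * ((G.Mhat *ᵥ a) ⬝ᵥ G.Shat *ᵥ (G.Mhat *ᵥ a)) := by
  obtain ⟨δ, hδ, hgap⟩ := G.exists_gap_Mhat
  have hh : ∀ a b : Fin D → ℝ, (G.Mhat *ᵥ a) ⬝ᵥ G.Shat *ᵥ (G.Mhat *ᵥ b) =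
      a ⬝ᵥ (G.Mhat * G.Shat * G.Mhat) *ᵥ b := fun a b => by
    rw [← mulVec_mulVec, ← mulVec_mulVec, dotProduct_mulVec_comm_of_symm G.Mhat_transpose a,
      dotProduct_comm]
  have hT : (G.Mhat * G.Shat * G.Mhat)ᵀ = G.Mhat * G.Shat * G.Mhat := by
    simp [transpose_mul, Mhat_transpose, Shat, Matrix.mul_assoc]
  obtain ⟨H, hH, hB⟩ := exists_abs_dotProduct_mulVec_le (G.Mhat * G.Shat * G.Mhat)
  -- With ρ the norm of the component of a outside the eigenspace, -K t³ is the minimum of t (δρ² -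
  -- 3H t ρ) over real ρ.
  refine ⟨(3 * H) ^ 2 / (4 * δ), H, hH, fun a ha ha1 => ?_⟩
  have hle : ∀ x : Fin D → ℝ, x ⬝ᵥ x ≤ 1 → √(x ⬝ᵥ x) ≤ 1 := fun x hx =>
    Real.sqrt_le_one.2 hx
  refine ⟨?_, fun t ht => ?_⟩
  · rw [hh]
    refine (le_abs_self _).trans ((hB a a).trans ?_)
    have := mul_le_one₀ (hle a ha1) (Real.sqrt_nonneg _) (hle a ha1)
    nlinarith
  obtain ⟨e, f, rfl, hef, he, hgf⟩ := hgap a ha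
  have hee : 0 ≤ e ⬝ᵥ e := Finset.sum_nonneg fun i _ => mul_self_nonneg (e i)
  have hff : 0 ≤ f ⬝ᵥ f := Finset.sum_nonneg fun i _ => mul_self_nonneg (f i)
  have hsum : (e + f) ⬝ᵥ (e + f) = e ⬝ᵥ e + f ⬝ᵥ f := by
    rw [add_dotProduct, dotProduct_add, dotProduct_add, dotProduct_comm f e, hef]; ring
  have he1 : e ⬝ᵥ e ≤ 1 := by linarith
  have hf1 : f ⬝ᵥ f ≤ 1 := by linarith
  have h1 : e ⬝ᵥ (G.Mhat * G.Shat * G.Mhat) *ᵥ e ≤ G.lambda2 ^ 2 * σ := by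
    rw [← hh, he, mulVec_smul, dotProduct_smul, smul_dotProduct, smul_eq_mul, smul_eq_mul,
      ← mul_assoc, ← sq]
    exact mul_le_mul_of_nonneg_left (G.lambda2_sq_mul_le hσ hmax he he1) (sq_nonneg _)
  set ρ := √(f ⬝ᵥ f)
  have hρ : ρ * ρ = f ⬝ᵥ f := Real.mul_self_sqrt hff
  have hρ0 : 0 ≤ ρ := Real.sqrt_nonneg _
  have h2 : e ⬝ᵥ (G.Mhat * G.Shat * G.Mhat) *ᵥ f ≤ H * ρ := by
    refine (le_abs_self _).trans ((hB e f).trans ?_)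
    exact mul_le_mul_of_nonneg_left (mul_le_of_le_one_left hρ0 (hle e he1)) hH
  have h3 : f ⬝ᵥ (G.Mhat * G.Shat * G.Mhat) *ᵥ f ≤ H * ρ := by
    refine (le_abs_self _).trans ((hB f f).trans ?_)
    exact mul_le_mul_of_nonneg_left (mul_le_of_le_one_left hρ0 (hle f hf1)) hH
  -- Two cross terms and the f-f term each cost at most Hρ.
  have h4 : (G.Mhat *ᵥ (e + f)) ⬝ᵥ G.Shat *ᵥ (G.Mhat *ᵥ (e + f)) ≤
      G.lambda2 ^ 2 * σ + 3 * H * ρ := by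
    rw [hh, mulVec_add, add_dotProduct, dotProduct_add, dotProduct_add,
      dotProduct_mulVec_comm_of_symm hT f e]
    linarith
  have h5 : 0 ≤ t * (δ * (ρ - t * (3 * H) / (2 * δ)) ^ 2) := by positivity
  have h6 : t * (δ * (ρ - t * (3 * H) / (2 * δ)) ^ 2) =
      t * (δ * (ρ * ρ)) - t ^ 2 * (3 * H * ρ) + (3 * H) ^ 2 / (4 * δ) * t ^ 3 := by
    field_simp
    ring
  rw [hρ] at h6
  have h7 := mul_le_mul_of_nonneg_left hgf ht
  have h8 := mul_le_mul_of_nonneg_left h4 (sq_nonneg t)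
  linarith

/-- The unit norm is shared between a and z, so the reduced problem, which compares with λ₂|a|²,
falls short by tλ₂|z|². The gap of `Lsub` pays for this with a fraction ct of z·Lsub z, and the
square is completed with the rest at a cost of order t³. -/
theorem exists_le_one_sub_rhoEss (G : NetworkOfNetworks D V) {β : ℝ} (hβ : 0 ≤ β) {σ : ℝ}
    (hσ : 0 ≤ σ) (hmax : ∀ v : Fin D → ℝ, G.IsUnitEigenvector2 v → v ⬝ᵥ G.Shat *ᵥ v ≤ σ) :
    ∃ C p₀ : ℝ, 0 < p₀ ∧ ∀ p : ℝ, 0 ≤ p → p ≤ p₀ →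
      p * β * G.lambda2 - (p * β) ^ 2 * (G.lambda2 ^ 2 * σ) - C * p ^ 3 ≤ 1 - G.rhoEss β p := by
  obtain ⟨K, H, hH, hred⟩ := G.exists_reduced_lower_bound hσ hmax
  obtain ⟨γ, hγ, hgap⟩ := G.exists_gap_Lsub
  have hl := G.lambda2_nonneg
  set c := G.lambda2 / γ
  have hc : 0 ≤ c := div_nonneg hl hγ.le
  have hcγ : c * γ = G.lambda2 := div_mul_cancel₀ _ hγ.ne'
  -- p₀ ensures ct ≤ 1/2; the added 1 keeps the denominator positive when cβ = 0.
  refine ⟨(K + 2 * c * H) * β ^ 3, 1 / (2 * (c * β + 1)), by positivity, fun p hp hp0 => ?_⟩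
  obtain ⟨x, hx0, hx1, hx⟩ := (G.rhoEss_spec hβ hp).2
  rw [hx]
  obtain ⟨a, z, rfl, hz⟩ := G.exists_eq_lift_add x
  rw [G.sum_lift_add a hz] at hx0
  rw [G.lift_add_dotProduct_self a hz] at hx1
  rw [dotProduct_Lsub_mulVec_lift_add, dotProduct_con_laplacian_mulVec_lift_add]
  obtain ⟨y, -, hy1, hy2⟩ := G.exists_corrector (G.Mhat *ᵥ a)
  rw [← hy1 z hz]
  set t := p * β
  have ht : 0 ≤ t := mul_nonneg hp hβ
  have htc : c * t ≤ 1 / 2 := by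
    rw [le_div_iff₀ (by positivity)] at hp0
    have : c * t = p * (c * β) := by simp only [t]; ring
    rw [this]
    linarith
  have hzz : 0 ≤ z ⬝ᵥ z := Finset.sum_nonneg fun i _ => mul_self_nonneg (z i)
  have hB0 : 0 ≤ z ⬝ᵥ G.con.laplacian *ᵥ z := by
    simpa using G.con.laplacian_posSemidef.dotProduct_mulVec_nonneg z
  have haa : a ⬝ᵥ a ≤ 1 := by linarith
  obtain ⟨hhH, hred⟩ := hred a hx0 haa
  replace hred := hred t ht
  have hh0 := G.dotProduct_Shat_mulVec_nonneg (G.Mhat *ᵥ a)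
  set h := (G.Mhat *ᵥ a) ⬝ᵥ G.Shat *ᵥ (G.Mhat *ᵥ a)
  have hpos : 0 < 1 - c * t := by linarith
  -- With the weight 1 - ct on z·Lsub z, the square is centred at z = -tq y and the loss is t² h q;
  -- q ≤ 1 + 2ct makes the excess over t² h cubic.
  set q := 1 / (1 - c * t)
  have hq : (1 - c * t) * q = 1 := mul_one_div_cancel hpos.ne'
  have hq1 : q ≤ 1 + 2 * (c * t) := by
    rw [div_le_iff₀ hpos]
    nlinarith [mul_nonneg hc ht]
  have hsq : 0 ≤ (1 - c * t) * (z ⬝ᵥ G.Lsub *ᵥ z + 2 * (t * q) * (z ⬝ᵥ G.Lsub *ᵥ y) +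
      (t * q) ^ 2 * h) := by
    refine mul_nonneg hpos.le ?_
    have h0 : 0 ≤ (z + (t * q) • y) ⬝ᵥ G.Lsub *ᵥ (z + (t * q) • y) := by
      simpa using G.Lsub_posSemidef.dotProduct_mulVec_nonneg (z + (t * q) • y)
    rw [mulVec_add, mulVec_smul, add_dotProduct, dotProduct_add, dotProduct_add, dotProduct_smul,
      smul_dotProduct, smul_dotProduct, dotProduct_smul, hy2,
      dotProduct_mulVec_comm_of_symm G.Lsub_transpose y z] at h0
    simp only [smul_eq_mul] at h0
    linarith
  have hsq' : (1 - c * t) * (z ⬝ᵥ G.Lsub *ᵥ z + 2 * (t * q) * (z ⬝ᵥ G.Lsub *ᵥ y) +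
      (t * q) ^ 2 * h) = (1 - c * t) * (z ⬝ᵥ G.Lsub *ᵥ z) + 2 * t * (z ⬝ᵥ G.Lsub *ᵥ y) +
        t ^ 2 * h * q := by
    linear_combination (2 * t * (z ⬝ᵥ G.Lsub *ᵥ y) + t ^ 2 * h * q) * hq
  have h1 : t ^ 2 * h * q ≤ t ^ 2 * h * (1 + 2 * (c * t)) :=
    mul_le_mul_of_nonneg_left hq1 (mul_nonneg (sq_nonneg t) hh0)
  have h2 : c * t ^ 3 * h ≤ c * t ^ 3 * H := mul_le_mul_of_nonneg_left hhH (by positivity)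
  have h3 : c * t * (γ * (z ⬝ᵥ z)) ≤ c * t * (z ⬝ᵥ G.Lsub *ᵥ z) :=
    mul_le_mul_of_nonneg_left (hgap z hz) (mul_nonneg hc ht)
  have h4 : c * t * (γ * (z ⬝ᵥ z)) = t * (G.lambda2 * (1 - a ⬝ᵥ a)) := by
    rw [← hcγ, ← hx1]; ring
  have h5 : (K + 2 * c * H) * β ^ 3 * p ^ 3 = (K + 2 * c * H) * t ^ 3 := by
    simp only [t]; ring
  have h6 := mul_nonneg ht hB0
  rw [h5]
  linarith

theorem isBigO_rhoEss (G : NetworkOfNetworks D V) {β : ℝ} (hβ : 0 ≤ β) {u : Fin D → ℝ}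
    (hu : G.IsUnitEigenvector2 u)
    (hmax : ∀ v : Fin D → ℝ, G.IsUnitEigenvector2 v → v ⬝ᵥ G.Shat *ᵥ v ≤ u ⬝ᵥ G.Shat *ᵥ u) :
    (fun p : ℝ => G.rhoEss β p - (1 - p * β * G.lambda2 +
      p ^ 2 * β ^ 2 * (G.lambda2 ^ 2 * (u ⬝ᵥ G.Shat *ᵥ u)))) =O[𝓝[≥] 0] fun p : ℝ => p ^ 3 := by
  obtain ⟨C₁, p₀, hp₀, h1⟩ :=
    G.exists_le_one_sub_rhoEss hβ (G.dotProduct_Shat_mulVec_nonneg u) hmax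
  obtain ⟨C₂, h2⟩ : ∃ C : ℝ, ∀ p : ℝ, 0 ≤ p → 1 - G.rhoEss β p ≤
      p * β * G.lambda2 - (p * β) ^ 2 * (G.lambda2 ^ 2 * (u ⬝ᵥ G.Shat *ᵥ u)) + C * p ^ 3 := by
    -- When λ₂ = 0, u need not be orthogonal to `sqrtSize`. The second-order term then vanishes, so
    -- an orthogonal eigenvector can replace u.
    by_cases h0 : G.lambda2 = 0
    · obtain ⟨v, hv, hv'⟩ := G.lambda2_spec.2
      obtain ⟨C, hC⟩ := G.one_sub_rhoEss_le hβ hv hv'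
      refine ⟨C, fun p hp => ?_⟩
      have := hC p hp
      rw [h0] at this ⊢
      linarith
    · exact G.one_sub_rhoEss_le hβ (G.sqrtSize_dotProduct_eigenvector h0 hu.2) hu
  refine IsBigO.of_bound (max C₁ C₂) ?_
  filter_upwards [Ico_mem_nhdsGE hp₀] with p hp
  have hp3 : 0 ≤ p ^ 3 := pow_nonneg hp.1 3
  have h3 := h1 p hp.1 hp.2.le
  have h4 := h2 p hp.1
  have h5 := mul_le_mul_of_nonneg_right (le_max_left C₁ C₂) hp3
  have h6 := mul_le_mul_of_nonneg_right (le_max_right C₁ C₂) hp3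
  rw [Real.norm_eq_abs, Real.norm_eq_abs, abs_of_nonneg hp3, abs_le]
  rw [mul_pow] at h3 h4
  constructor <;> linarith

theorem exists_maximizer (G : NetworkOfNetworks D V) :
    ∃ u : Fin D → ℝ, G.IsUnitEigenvector2 u ∧
      ∀ v : Fin D → ℝ, G.IsUnitEigenvector2 v → v ⬝ᵥ G.Shat *ᵥ v ≤ u ⬝ᵥ G.Shat *ᵥ u := by
  have hK : IsCompact {u | G.IsUnitEigenvector2 u} :=
    isCompact_unitSphere.inter_right
      (isClosed_eq (f := fun u => G.Mhat *ᵥ u) (by fun_prop) (by fun_prop))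
  obtain ⟨v, -, hv⟩ := G.lambda2_spec.2
  obtain ⟨u, hu, hmax⟩ := hK.exists_isMaxOn ⟨v, hv⟩ (f := fun x => x ⬝ᵥ G.Shat *ᵥ x)
    (Continuous.continuousOn (by fun_prop))
  exact ⟨u, hu, fun v hv => hmax hv⟩

/-- If λ₂ were 0, its eigenvector orthogonal to `sqrtSize` would lift to a null vector of the
connecting Laplacian. Connectedness would make that constant on the connecting nodes, so the
eigenvector would be parallel to `sqrtSize`. Minimality holds since eigenvectors for nonzero
eigenvalues are orthogonal to `sqrtSize`. -/
theorem isLeast_lambda2 (G : NetworkOfNetworks D V) (hG : G.conHat.Connected) :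
    IsLeast {μ : ℝ | Module.End.HasEigenvalue (Matrix.toLin' G.Mhat) μ ∧ μ ≠ 0} G.lambda2 := by
  obtain ⟨hmin, u, hru, hu1, hu⟩ := G.lambda2_spec
  have hu0 : u ≠ 0 := fun h => by simp [h] at hu1
  refine ⟨⟨Module.End.hasEigenvalue_of_hasEigenvector (x := u)
    ⟨Module.End.mem_eigenspace_iff.2 (by simpa using hu), hu0⟩, fun h0 => ?_⟩, ?_⟩
  · have h1 : G.lift u ⬝ᵥ G.con.laplacian *ᵥ G.lift u = 0 := by
      rw [lift_dotProduct_con_laplacian_mulVec_lift, hu, h0, zero_smul, dotProduct_zero]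
    have h2 : G.con.laplacian *ᵥ G.lift u = 0 :=
      (G.con.laplacian_posSemidef.dotProduct_mulVec_zero_iff _).1 (by simpa using h1)
    have h3 : ∀ i j, G.restrict (G.lift u) i = G.restrict (G.lift u) j := by
      intro i j
      obtain ⟨w⟩ := hG.preconnected i j
      induction w with
      | nil => rfl
      | cons h _ ih =>
        exact (G.con.eq_of_adj_of_laplacian_mulVec_eq_zero h2
          (r := G.conNode _) (s := G.conNode _) h).trans ih
    let k : Fin D := ⟨0, by have := G.two_le; omega⟩
    have h4 : u = (G.restrict (G.lift u) k) • G.sqrtSize := by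
      ext i
      rw [Pi.smul_apply, ← h3 i k, restrict_lift, smul_eq_mul, mul_right_comm,
        inv_mul_cancel₀ (G.sqrtSize_pos i).ne', one_mul]
    have h5 : u ⬝ᵥ u = 0 := by
      nth_rw 1 [h4]
      rw [smul_dotProduct, hru, smul_zero]
    exact zero_ne_one (h5.symm.trans hu1)
  · rintro μ ⟨hμ, hμ0⟩
    obtain ⟨v, hv, hv0⟩ := hμ.exists_hasEigenvector
    have hv' : G.Mhat *ᵥ v = μ • v := by simpa using Module.End.mem_eigenspace_iff.1 hv
    have h1 := hmin v (G.sqrtSize_dotProduct_eigenvector hμ0 hv')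
    rw [hv', dotProduct_smul, smul_eq_mul] at h1
    refine le_of_mul_le_mul_right h1 (lt_of_le_of_ne ?_ fun h => hv0 ?_)
    · exact Finset.sum_nonneg fun i _ => mul_self_nonneg (v i)
    · exact dotProduct_self_eq_zero.1 h.symm

end NetworkOfNetworks

/-! ### Assembly of the expansions. -/

theorem mainTheorem5 {D : ℕ} {V : Fin D → Type*} [∀ i, Fintype (V i)] [∀ i, DecidableEq (V i)]
    (G : NetworkOfNetworks D V) (β : ℝ) (hβ : 0 ≤ β) :
    -- for a connected connecting graph, `lambda2` is the smallest nonzero eigenvalue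
    (G.conHat.Connected →
      IsLeast {μ : ℝ | Module.End.HasEigenvalue (Matrix.toLin' G.Mhat) μ ∧ μ ≠ 0} G.lambda2) ∧
    -- first order in `p`
    ((fun p : ℝ => G.rhoEss β p - (1 - p * β * G.lambda2)) =O[𝓝[≥] 0] fun p : ℝ => p ^ 2) ∧
    -- second order in `p`, for a simple eigenvalue `lambda2`
    (Module.finrank ℝ (Module.End.eigenspace (Matrix.toLin' G.Mhat) G.lambda2) = 1 →
      ∀ u : Fin D → ℝ, G.IsUnitEigenvector2 u →
        (fun p : ℝ => G.rhoEss β p - (1 - p * β * G.lambda2 +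
          p ^ 2 * β ^ 2 * (G.lambda2 ^ 2 * (u ⬝ᵥ G.Shat *ᵥ u)))) =O[𝓝[≥] 0] fun p : ℝ => p ^ 3) ∧
    -- second order in `p`, in general: `u` maximizes the quadratic form among the eigenvectors
    (∃ u : Fin D → ℝ, G.IsUnitEigenvector2 u ∧
      ∀ v : Fin D → ℝ, G.IsUnitEigenvector2 v → v ⬝ᵥ G.Shat *ᵥ v ≤ u ⬝ᵥ G.Shat *ᵥ u) ∧
    (∀ u : Fin D → ℝ, G.IsUnitEigenvector2 u →
      (∀ v : Fin D → ℝ, G.IsUnitEigenvector2 v → v ⬝ᵥ G.Shat *ᵥ v ≤ u ⬝ᵥ G.Shat *ᵥ u) →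
        (fun p : ℝ => G.rhoEss β p - (1 - p * β * G.lambda2 +
          p ^ 2 * β ^ 2 * (G.lambda2 ^ 2 * (u ⬝ᵥ G.Shat *ᵥ u)))) =O[𝓝[≥] 0] fun p : ℝ => p ^ 3) := by
  refine ⟨G.isLeast_lambda2, ?_, fun hdim u hu => G.isBigO_rhoEss hβ hu fun v hv => ?_,
    G.exists_maximizer, fun u hu hmax => G.isBigO_rhoEss hβ hu hmax⟩
  -- The first-order claim is the second-order one for a maximizer, with the p² term absorbed into
  -- the error.
  · obtain ⟨u, hu, hmax⟩ := G.exists_maximizer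
    have h32 : (fun p : ℝ => p ^ 3) =O[𝓝[≥] 0] fun p : ℝ => p ^ 2 := by
      refine IsBigO.of_bound 1 ?_
      filter_upwards [Ico_mem_nhdsGE one_pos] with p hp
      rw [Real.norm_of_nonneg (pow_nonneg hp.1 3), Real.norm_of_nonneg (pow_nonneg hp.1 2), one_mul]
      exact pow_le_pow_of_le_one hp.1 hp.2.le (by norm_num)
    have h22 := (isBigO_refl (fun p : ℝ => p ^ 2) (𝓝[≥] 0)).const_mul_left
      (β ^ 2 * (G.lambda2 ^ 2 * (u ⬝ᵥ G.Shat *ᵥ u)))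
    refine (((G.isBigO_rhoEss hβ hu hmax).trans h32).add h22).congr_left fun p => ?_
    ring
  · have hu0 : u ≠ 0 := fun h => by simpa [h] using hu.1
    have hmem : ∀ w, G.IsUnitEigenvector2 w →
        w ∈ Module.End.eigenspace (Matrix.toLin' G.Mhat) G.lambda2 := fun w hw =>
      Module.End.mem_eigenspace_iff.2 (by simpa using hw.2)
    -- In a one-dimensional eigenspace v = c u with c² = 1, so all unit eigenvectors give the same
    -- value and u is a maximizer.
    obtain ⟨c, hc⟩ := (finrank_eq_one_iff_of_nonzero' (⟨u, hmem u hu⟩ :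
      Module.End.eigenspace (Matrix.toLin' G.Mhat) G.lambda2)
      fun h => hu0 (congrArg Subtype.val h)).1 hdim ⟨v, hmem v hv⟩
    have hv' : v = c • u := (congrArg Subtype.val hc).symm
    have h1 := hv.1
    rw [hv', smul_dotProduct, dotProduct_smul, hu.1, smul_eq_mul, smul_eq_mul, mul_one] at h1
    rw [hv', mulVec_smul, smul_dotProduct, dotProduct_smul, smul_eq_mul, smul_eq_mul, ← mul_assoc,
      h1, one_mul]
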